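/- **Setting.** Let $d,n,T\ge 1$ be integers, $D,\sigma,H\ge 0$ and $R,\eta>0$ be reals, and $\Omega=\{w\in\mathbb R^d:\|w\|_2\le D\}$. Let $F:\mathbb R^d\to\mathbb R$ be convex on $\Omega$, differentiable at the points of $\Omega$, and $H$-smooth there: $\|\nabla F(w)-\nabla F(w')\|_2\le H\|w-w'\|_2$ for all $w,w'\in\Omega$. Let $g$ be a stochastic gradient oracle with, for all $w\in\Omega$, $\mathbb E[g(w)]=\nabla F(w)$, $\|g(w)\|_2\le R$ almost surely, and $\mathbb E\|g(w)-\nabla F(w)\|_2^2\le\sigma^2$. **Quantizer.** Put $k=\max(2,\lceil\sqrt d\,\rceil)$ and $\beta=\frac{k+1}{k(k-1)}$. Given inputs $x_1,\dots,x_n\in\mathbb R^d$ with $\|x_i\|_2\le R$, for each coordinate $j$ independently draw, as shared randomness, $c^j$ uniform on $[-\frac1k,0)$, a uniformly random permutation $\pi^j$ of $\{0,\dots,n-1\}$, and $\gamma_i^j$ uniform on $[0,\frac1n)$ for each client $i$, all independent. Client $i$ sets $y=\frac{x_i(j)+R}{2R}$, lets $m$ be the largest index in $\{0,\dots,k-1\}$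 with $c^j+m\beta<y$, and replaces $m$ by $m+1$ if $\frac{\pi_i^j}{n}+\gamma_i^j<\frac{y-(c^j+m\beta)}{\beta}$. It sends the resulting $d$ indices as one bit string, each index $m$ being written in the Elias gamma code after the offset $m-\lfloor k/2\rfloor$ has been mapped to a positive integer by $0,-1,1,-2,2,\dots\mapsto 1,2,3,4,5,\dots$. The server decodes the strings and outputs the average over the clients of the vectors with coordinates $-R+2R(c^j+m\beta)$. **Algorithm.** Projected distributed SGD starts at a random $w_0\in\Omega$ with $\mathbb E[w_0]=0$ (for instance uniform on $\Omega$, or $w_0=0$). In round $t=0,\dots,T-1$ each of the $n$ clients queries the oracle at $w_t$ with independent fresh randomness and quantizes the answer as above with fresh shared randomness, independent of the oracle answers. With $\widehat\nabla F(w_t)$ the output of the server, $w_{t+1}$ is the Euclidean projection onto $\Omega$ of $w_t-\frac{1}{H+1/\eta}\widehat\nabla F(w_t)$. **Theorem.** There are absolute constants $C,a,b>0$ such that in every such setting the expectation below exists and $$\mathbb E\Big[F\Big(\frac1T\sum_{t=1}^T w_t\Big)\Big]-\min_{w\in\Omega}F(w)\le\Big(H+\frac1\eta\Big)\frac{D^2}{T}+\frac{\eta\triangle^2}{2},\qquad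 \triangle^2=C\Big(\frac{\sigma R}{n}+\frac{R^2}{n^2}\Big),$$ and, almost surely, in every round each client sends at least $a\,d$ and at most $b\,d$ bits, that is, $\Theta(d)$ bits. -/

import Mathlib

open MeasureTheory ProbabilityTheory

namespace CQ

noncomputable section

/-! ## Lossless variable-length coding of level indices (Elias gamma code) -/

/-- Elias gamma code of a positive integer `N`: `⌊log₂ N⌋` zeros (`false`), followed by the binary
expansion of `N`, most significant bit first. -/
def gammaEncode (N : ℕ) : List Bool :=
  List.replicate (Nat.log 2 N) false ++ (Nat.bits N).reverse

/-- Reads one Elias gamma code word from the front of a bit string and returns the integer together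
with the unread rest of the string. -/
def gammaDecode (s : List Bool) : ℕ × List Bool :=
  let L := (s.takeWhile (fun b => !b)).length
  let u := s.drop L
  ((u.take (L + 1)).foldl (fun a b => 2 * a + b.toNat) 0, u.drop (L + 1))

/-- Bit string sent for the vector `v` of level indices in `{0, …, k - 1}`: coordinate by coordinate,
the offset of the index from the middle index `k / 2` is turned into a positive integer by
`0, -1, 1, -2, 2, … ↦ 1, 2, 3, 4, 5, …` and written in the Elias gamma code. -/
def encode (k : ℕ) {d : ℕ} (v : Fin d → ℕ) : List Bool :=
  (List.ofFn v).flatMap fun m => gammaEncode (Equiv.intEquivNat ((m : ℤ) - (k / 2 : ℕ)) + 1)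

/-- The server's decoder for `encode`. -/
def decode (k : ℕ) : (d : ℕ) → List Bool → (Fin d → ℕ)
  | 0, _ => Fin.elim0
  | d + 1, s =>
    Fin.cons (Equiv.intEquivNat.symm ((gammaDecode s).1 - 1) + (k / 2 : ℕ)).toNat
      (decode k d (gammaDecode s).2)

/-! ## Correlated quantization with `k` levels in one dimension -/

/-- Randomness used for one coordinate in one round: the first level `c₁`, the permutation `π` and
the offsets `γ i`, one for each of the `n` clients. -/
abbrev CoordSeed (n : ℕ) : Type := ℝ × Equiv.Perm (Fin n) × (Fin n → ℝ)

instance (n : ℕ) : MeasurableSpace (Equiv.Perm (Fin n)) := ⊤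

/-- Law of the randomness of one coordinate: `c₁` uniform on `[-1/k, 0)`, `π` a uniformly random
permutation, every `γ i` uniform on `[0, 1/n)`, all independent. -/
def coordLaw (n k : ℕ) : Measure (CoordSeed n) :=
  (cond volume (Set.Ico (-(1 / (k : ℝ))) 0)).prod
    ((PMF.uniformOfFintype (Equiv.Perm (Fin n))).toMeasure.prod
      (Measure.pi fun _ : Fin n => cond volume (Set.Ico (0 : ℝ) (1 / (n : ℝ)))))

/-- The distance `β` of consecutive levels. The levels are `c₁ + j β`, `j = 0, …, k - 1`. -/
def spacing (k : ℕ) : ℝ := ((k : ℝ) + 1) / ((k : ℝ) * ((k : ℝ) - 1))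

/-- The largest index `j < k` such that the level `c₁ + j β` is less than `y`. -/
def lowerIndex (k : ℕ) (c₁ y : ℝ) : ℕ :=
  ((Finset.range k).filter fun j : ℕ => c₁ + j * spacing k < y).sup id

/-- Index of the level to which client `i` rounds its input `x ∈ [l, r]`: with `y` the input rescaled
to `[0, 1]` and `c'` the largest level below `y`, the client rounds up from `c'` to the next level
if `U i < (y - c') / β`, where `U i = π i / n + γ i`, and down to `c'` otherwise. -/
def levelIndex (k : ℕ) (l r : ℝ) {n : ℕ} (s : CoordSeed n) (i : Fin n) (x : ℝ) : ℕ :=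
  let y : ℝ := (x - l) / (r - l)
  let m : ℕ := lowerIndex k s.1 y
  let c' : ℝ := s.1 + m * spacing k
  let U : ℝ := ((s.2.1 i : ℕ) : ℝ) / n + s.2.2 i
  if U < (y - c') / spacing k then m + 1 else m

/-- The point of `ℝ` represented by a level index, after scaling back to `[l, r]`. -/
def levelValue (k : ℕ) (l r c₁ : ℝ) (m : ℕ) : ℝ := l + (r - l) * (c₁ + m * spacing k)

/-! ## Correlated quantization in `ℝᵈ` for inputs in the Euclidean ball of radius `R` -/

/-- The bit string sent by client `i` when its input is `x`; every coordinate is quantized over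
`[-R, R]` with its own randomness. -/
def message (k : ℕ) (R : ℝ) {n d : ℕ} (s : Fin d → CoordSeed n) (i : Fin n)
    (x : EuclideanSpace ℝ (Fin d)) : List Bool :=
  encode k fun j => levelIndex k (-R) R (s j) i (x j)

/-- The server's estimate of the mean, computed from the received bit strings and the shared
randomness. -/
def serverEstimate (k : ℕ) (R : ℝ) {n d : ℕ} (s : Fin d → CoordSeed n)
    (msg : Fin n → List Bool) : EuclideanSpace ℝ (Fin d) :=
  (1 / (n : ℝ)) • ∑ i : Fin n,
    WithLp.toLp 2 fun j : Fin d => levelValue k (-R) R (s j).1 (decode k d (msg i) j)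

/-- The number of levels `k = √d`, rounded up, and at least `2`. -/
def numLevels (d : ℕ) : ℕ := max 2 ⌈Real.sqrt (d : ℝ)⌉₊

/-! ## Projected distributed SGD -/

/-- `g` is a stochastic gradient oracle of `F` on the ball `‖w‖ ≤ D`, driven by a sample from `P`:
unbiased, bounded by `R`, with variance at most `σ ^ 2`. -/
structure IsGradientOracle {d : ℕ} {Ξ : Type*} [MeasurableSpace Ξ]
    (F : EuclideanSpace ℝ (Fin d) → ℝ) (D R σ : ℝ) (P : Measure Ξ)
    (g : EuclideanSpace ℝ (Fin d) → Ξ → EuclideanSpace ℝ (Fin d)) : Prop where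
  measurable : Measurable (Function.uncurry g)
  unbiased : ∀ w, ‖w‖ ≤ D → ∫ ξ, g w ξ ∂P = gradient F w
  bounded : ∀ w, ‖w‖ ≤ D → ∀ᵐ ξ ∂P, ‖g w ξ‖ ≤ R
  variance : ∀ w, ‖w‖ ≤ D → ∫ ξ, ‖g w ξ - gradient F w‖ ^ 2 ∂P ≤ σ ^ 2

/-- Randomness of one round: one oracle sample for each client, and the shared randomness of the
quantizer for each coordinate. -/
abbrev RoundSeed (n d : ℕ) (Ξ : Type*) : Type _ := (Fin n → Ξ) × (Fin d → CoordSeed n)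

/-- Law of the randomness of the whole run: an initial point with law `μ₀` and, independently,
`T` independent rounds; in each of them the oracle samples of the clients and the randomness of the
coordinates are all independent. -/
def runLaw (n d T : ℕ) {Ξ : Type*} [MeasurableSpace Ξ] (P : Measure Ξ)
    (μ₀ : Measure (EuclideanSpace ℝ (Fin d))) :
    Measure (EuclideanSpace ℝ (Fin d) × (Fin T → RoundSeed n d Ξ)) :=
  μ₀.prod (Measure.pi fun _ : Fin T =>
    (Measure.pi fun _ : Fin n => P).prod (Measure.pi fun _ : Fin d => coordLaw n (numLevels d)))

/-- Metric projection onto the closed Euclidean ball of radius `D` around the origin. -/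
def projBall {d : ℕ} (D : ℝ) (w : EuclideanSpace ℝ (Fin d)) : EuclideanSpace ℝ (Fin d) :=
  if ‖w‖ ≤ D then w else (D / ‖w‖) • w

/-- The bit string that client `i` sends in a round in which all clients query the oracle at `w`. -/
def clientMessage (R : ℝ) {n d : ℕ} {Ξ : Type*}
    (g : EuclideanSpace ℝ (Fin d) → Ξ → EuclideanSpace ℝ (Fin d))
    (w : EuclideanSpace ℝ (Fin d)) (s : RoundSeed n d Ξ) (i : Fin n) : List Bool :=
  message (numLevels d) R s.2 i (g w (s.1 i))

/-- One round with learning rate `lr`. -/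
def sgdStep (D R lr : ℝ) {n d : ℕ} {Ξ : Type*}
    (g : EuclideanSpace ℝ (Fin d) → Ξ → EuclideanSpace ℝ (Fin d))
    (w : EuclideanSpace ℝ (Fin d)) (s : RoundSeed n d Ξ) : EuclideanSpace ℝ (Fin d) :=
  projBall D (w - lr • serverEstimate (numLevels d) R s.2 (clientMessage R g w s))

/-- The iterates `w₀, …, w_T` of a run. -/
def iterate (D R lr : ℝ) {n d T : ℕ} {Ξ : Type*}
    (g : EuclideanSpace ℝ (Fin d) → Ξ → EuclideanSpace ℝ (Fin d))
    (ω : EuclideanSpace ℝ (Fin d) × (Fin T → RoundSeed n d Ξ)) :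
    Fin (T + 1) → EuclideanSpace ℝ (Fin d) :=
  Fin.induction (motive := fun _ => EuclideanSpace ℝ (Fin d)) ω.1
    (fun t w => sgdStep D R lr g w (ω.2 t))

/-- The averaged iterate `(w₁ + ⋯ + w_T) / T`. -/
def averagedIterate (D R lr : ℝ) {n d T : ℕ} {Ξ : Type*}
    (g : EuclideanSpace ℝ (Fin d) → Ξ → EuclideanSpace ℝ (Fin d))
    (ω : EuclideanSpace ℝ (Fin d) × (Fin T → RoundSeed n d Ξ)) : EuclideanSpace ℝ (Fin d) :=
  (1 / (T : ℝ)) • ∑ t : Fin T, iterate D R lr g ω t.succ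

end

end CQ

namespace CQ

noncomputable section

/-! ## The Elias gamma code -/

/-! The quantizer behaves as if the server received the exact oracle answers plus a small error of
mean zero. Put `v = (y - c₁) / β`; client `i` then sends the index `⌈v - U i⌉`, so its error is
`2Rβ` times `ceilError v (U i)`. The dithers `U i = π i / n + γ i` place one point in each cell
`[l/n, (l+1)/n)`. This is the correlation that helps: if all clients held the same `v`, Hermite's
identity would make their errors add up to at most 1 in absolute value (`abs_sum_ceilError_le`),
however large `n` is.

For different inputs `w i`, each error is compared with the error at a common reference `v` and the
same dither. The difference takes two values that are 1 apart and has mean zero, so its variance is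
at most `|w i - v|`. Given `π` these differences are independent; what `π` adds is controlled by a
second moment bound for sums along a random permutation (`sum_perm_sq_le`). Hence the total error
has second moment at most `2 + 6 ∑ |w i - v|` (`integral_sum_ceilError_sq_le`). With the coordinates
of `∇F(w)` as reference, and since `β √d` is bounded, summing over coordinates gives mean squared
error of order `R²/n² + (R/n²) ∑ ‖g_i - ∇F(w)‖`. Its expectation is of order `R²/n² + σR/n`. The
sampling error of the average is also of order `σR/n`, because `‖g - ∇F‖² ≤ 2R ‖g - ∇F‖`.

Convergence is the usual analysis of projected SGD with step `1 / (H + 1/η)`: a one-step inequality,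
in which `H` pays for smoothness and `1/η` for the noise, is averaged over the round and telescoped
(`projBall_step_le`, `integral_averagedIterate_sub_le`). The randomness of a round is independent of
its starting iterate (`measurePreserving_iterate_prodMk`).

For the bits, an index lies within `O(1) + k|x j|/(2R)` of the middle one. By Cauchy–Schwarz these
offsets sum to `O(d)`, and the length of a code word is at most linear in the offset. -/

lemma log_two_add_one_eq_length_bits {N : ℕ} (hN : N ≠ 0) : Nat.log 2 N + 1 = N.bits.length := by
  rw [Nat.size_eq_bits_len]
  refine le_antisymm ?_ ?_
  · exact Nat.lt_size.2 (Nat.pow_log_le_self 2 hN)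
  · exact Nat.size_le.2 (Nat.lt_pow_succ_log_self (by norm_num) N)

lemma foldl_reverse_bits (N : ℕ) :
    N.bits.reverse.foldl (fun a b => 2 * a + b.toNat) 0 = N := by
  rw [List.foldl_reverse]
  induction N using Nat.binaryRec' with
  | zero => simp
  | bit b n h ih =>
    rw [Nat.bits_append_bit n b h, List.foldr_cons, ih]
    cases b <;> simp [Nat.bit]

lemma exists_reverse_bits_eq_true_cons {N : ℕ} (hN : N ≠ 0) :
    ∃ l, N.bits.reverse = true :: l := by
  induction N using Nat.binaryRec' with
  | zero => exact absurd rfl hN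
  | bit b n h ih =>
    rw [Nat.bits_append_bit n b h, List.reverse_cons]
    by_cases hn : n = 0
    · subst hn
      exact ⟨[], by simp [h rfl]⟩
    · obtain ⟨l, hl⟩ := ih hn
      exact ⟨l ++ [b], by rw [hl]; rfl⟩

lemma length_gammaEncode {N : ℕ} (hN : N ≠ 0) :
    (gammaEncode N).length = 2 * Nat.log 2 N + 1 := by
  have := log_two_add_one_eq_length_bits hN
  simp only [gammaEncode, List.length_append, List.length_replicate, List.length_reverse]
  omega

/-- The leading binary digit is 1, so the run of zeros ends exactly where the expansion starts. Its
length then tells how many digits follow. Allowing an arbitrary tail `r` makes the code usable in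
concatenations. -/
lemma gammaDecode_gammaEncode_append {N : ℕ} (hN : N ≠ 0) (r : List Bool) :
    gammaDecode (gammaEncode N ++ r) = (N, r) := by
  obtain ⟨l, hl⟩ := exists_reverse_bits_eq_true_cons hN
  have hlen : N.bits.reverse.length = Nat.log 2 N + 1 := by
    rw [List.length_reverse, log_two_add_one_eq_length_bits hN]
  have htake : ((gammaEncode N ++ r).takeWhile (fun b => !b)).length = Nat.log 2 N := by
    rw [gammaEncode, hl, List.append_assoc, List.takeWhile_append_of_pos]
    · simp
    · intro a ha
      simp [List.eq_of_mem_replicate ha]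
  have hdrop : (gammaEncode N ++ r).drop (Nat.log 2 N) = N.bits.reverse ++ r := by
    rw [gammaEncode, List.append_assoc, List.drop_left' (by simp)]
  simp only [gammaDecode, htake, hdrop]
  rw [List.take_left' hlen, List.drop_left' hlen, foldl_reverse_bits]

/-- No bound on the indices is needed: the code covers all integers, and `toNat` loses nothing
because the decoded value is a natural number. -/
lemma decode_encode (k : ℕ) {d : ℕ} (v : Fin d → ℕ) : decode k d (encode k v) = v := by
  induction d with
  | zero => exact funext fun i => i.elim0
  | succ d ih =>
    have h : encode k v = gammaEncode (Equiv.intEquivNat ((v 0 : ℤ) - (k / 2 : ℕ)) + 1) ++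
        encode k (fun i => v i.succ) := by
      simp [encode, List.ofFn_succ]
    rw [decode, h, gammaDecode_gammaEncode_append (Nat.succ_ne_zero _), ih]
    funext i
    refine Fin.cases ?_ (fun i => ?_) i
    · rw [Fin.cons_zero]
      simp
    · rw [Fin.cons_succ]

lemma intEquivNat_le (z : ℤ) : Equiv.intEquivNat z ≤ 2 * z.natAbs := by
  cases z with
  | ofNat n =>
    change 2 * n ≤ _
    simp
  | negSucc n =>
    change 2 * n + 1 ≤ _
    simp only [Int.natAbs_negSucc]
    omega

lemma length_encode (k : ℕ) {d : ℕ} (v : Fin d → ℕ) :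
    (encode k v).length =
      ∑ j, (2 * Nat.log 2 (Equiv.intEquivNat ((v j : ℤ) - (k / 2 : ℕ)) + 1) + 1) := by
  simp only [encode, List.length_flatMap, length_gammaEncode (Nat.succ_ne_zero _)]
  simp only [List.bind_eq_flatMap, List.pure_def, ← List.map_eq_flatMap, List.map_map]
  rw [List.map_ofFn, List.sum_ofFn]
  rfl

lemma le_length_encode (k : ℕ) {d : ℕ} (v : Fin d → ℕ) : d ≤ (encode k v).length := by
  rw [length_encode]
  calc d = ∑ _j : Fin d, 1 := by simp
    _ ≤ _ := Finset.sum_le_sum fun j _ => by omega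

/-- The crude bound `log₂ N < N` suffices, because the offsets themselves will be seen to add up to
`O(d)`. -/
lemma length_encode_le (k : ℕ) {d : ℕ} (v : Fin d → ℕ) :
    ((encode k v).length : ℝ) ≤ ∑ j, (4 * |(v j : ℝ) - (k / 2 : ℕ)| + 2) := by
  rw [length_encode, Nat.cast_sum]
  refine Finset.sum_le_sum fun j _ => ?_
  set z : ℤ := (v j : ℤ) - (k / 2 : ℕ) with hz
  have h1 := intEquivNat_le z
  have h2 : Nat.log 2 (Equiv.intEquivNat z + 1) < Equiv.intEquivNat z + 1 :=
    Nat.log_lt_self 2 (Nat.succ_ne_zero _)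
  have h3 : 2 * Nat.log 2 (Equiv.intEquivNat z + 1) + 1 ≤ 4 * z.natAbs + 2 := by omega
  have h4 : ((z.natAbs : ℕ) : ℝ) = |(v j : ℝ) - (k / 2 : ℕ)| := by
    rw [Nat.cast_natAbs, Int.cast_abs, hz]
    push_cast
    rfl
  rw [← h4]
  exact_mod_cast h3

/-! ## Level indices as dithered ceilings -/

/-- The dither `U i = π i / n + γ i` of client `i`. -/
def dither {n : ℕ} (s : Equiv.Perm (Fin n) × (Fin n → ℝ)) (i : Fin n) : ℝ :=
  ((s.1 i : ℕ) : ℝ) / n + s.2 i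

lemma spacing_pos {k : ℕ} (hk : 2 ≤ k) : 0 < spacing k := by
  have : (2 : ℝ) ≤ k := by exact_mod_cast hk
  unfold spacing
  apply div_pos <;> nlinarith

lemma spacing_mul_le {k : ℕ} (hk : 2 ≤ k) : spacing k * k ≤ 3 := by
  have : (2 : ℝ) ≤ k := by exact_mod_cast hk
  unfold spacing
  rw [div_mul_eq_mul_div, div_le_iff₀ (by nlinarith)]
  nlinarith

lemma inv_spacing_le {k : ℕ} (hk : 2 ≤ k) : (spacing k)⁻¹ ≤ k := by
  have : (2 : ℝ) ≤ k := by exact_mod_cast hk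
  unfold spacing
  rw [inv_div, div_le_iff₀ (by linarith)]
  nlinarith

/-- Since `(k - 1) β = 1 + 1/k`, the top level is at least 1 for every admissible `c`. So capping
the indices below `k` never interferes with the rounding. -/
lemma div_spacing_le {k : ℕ} (hk : 2 ≤ k) {c y : ℝ} (hc : c ∈ Set.Ico (-(1 / (k : ℝ))) 0)
    (hy : y ∈ Set.Icc (0 : ℝ) 1) : (y - c) / spacing k ≤ (k : ℝ) - 1 := by
  have h2 : (2 : ℝ) ≤ k := by exact_mod_cast hk
  rw [div_le_iff₀ (spacing_pos hk)]
  have h : ((k : ℝ) - 1) * spacing k = 1 + 1 / k := by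
    unfold spacing
    have : (k : ℝ) - 1 ≠ 0 := by linarith
    have : (k : ℝ) ≠ 0 := by linarith
    field_simp
  rw [h]
  linarith [hc.1, hy.2]

lemma div_spacing_pos {k : ℕ} (hk : 2 ≤ k) {c y : ℝ} (hc : c ∈ Set.Ico (-(1 / (k : ℝ))) 0)
    (hy : y ∈ Set.Icc (0 : ℝ) 1) : 0 < (y - c) / spacing k :=
  div_pos (by linarith [hc.2, hy.1]) (spacing_pos hk)

lemma lowerIndex_eq {k : ℕ} (hk : 2 ≤ k) {c y : ℝ} (hc : c ∈ Set.Ico (-(1 / (k : ℝ))) 0)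
    (hy : y ∈ Set.Icc (0 : ℝ) 1) : (lowerIndex k c y : ℤ) = ⌈(y - c) / spacing k⌉ - 1 := by
  set v := (y - c) / spacing k with hv
  have hv0 : 0 < v := div_spacing_pos hk hc hy
  have hvk : v ≤ (k : ℝ) - 1 := div_spacing_le hk hc hy
  have hiff : ∀ j : ℕ, c + j * spacing k < y ↔ (j : ℝ) < v := fun j => by
    rw [hv, lt_div_iff₀ (spacing_pos hk)]
    constructor <;> intro h <;> linarith
  obtain ⟨m, hm⟩ : ∃ m : ℕ, ⌈v⌉ = (m : ℤ) + 1 :=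
    ⟨(⌈v⌉ - 1).toNat, by have := Int.ceil_pos.2 hv0; omega⟩
  have hmv := Int.ceil_eq_iff.1 hm
  push_cast at hmv
  have hmk : m < k := by
    have : (m : ℝ) < k := by linarith
    exact_mod_cast this
  have : lowerIndex k c y = m := by
    refine le_antisymm (Finset.sup_le fun j hj => ?_) ?_
    · have hj' := (hiff j).1 (Finset.mem_filter.1 hj).2
      have : (j : ℝ) < m + 1 := by linarith
      have : j < m + 1 := by exact_mod_cast this
      simp only [id]
      omega
    · refine Finset.le_sup (f := id) (Finset.mem_filter.2 ⟨Finset.mem_range.2 hmk, ?_⟩)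
      rw [hiff]
      linarith
  rw [this, hm]
  ring

/-- With `m = ⌈v⌉ - 1` the rounding rule compares `U` with `v - m`, which lies in `(0, 1]`. Both
branches are therefore the single expression `⌈v - U⌉`, to which Hermite's identity applies. -/
lemma levelIndex_eq_ceil {k : ℕ} (hk : 2 ≤ k) {l r x : ℝ} {n : ℕ} {s : CoordSeed n} {i : Fin n}
    (hc : s.1 ∈ Set.Ico (-(1 / (k : ℝ))) 0) (hU : dither s.2 i ∈ Set.Ico (0 : ℝ) 1)
    (hy : (x - l) / (r - l) ∈ Set.Icc (0 : ℝ) 1) :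
    (levelIndex k l r s i x : ℤ) = ⌈((x - l) / (r - l) - s.1) / spacing k - dither s.2 i⌉ := by
  have hm := lowerIndex_eq hk hc hy
  have hβ := spacing_pos hk
  set v := ((x - l) / (r - l) - s.1) / spacing k with hv
  have hfrac : ((x - l) / (r - l) -
      (s.1 + (lowerIndex k s.1 ((x - l) / (r - l)) : ℕ) * spacing k)) / spacing k =
      v - (lowerIndex k s.1 ((x - l) / (r - l)) : ℕ) := by
    rw [hv]
    field_simp
    ring
  have hceil := Int.ceil_eq_iff.1 (show ⌈v⌉ = (lowerIndex k s.1 ((x - l) / (r - l)) : ℤ) + 1 by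
    rw [hm]; ring)
  push_cast at hceil
  unfold levelIndex
  simp only
  rw [hfrac]
  change ((if dither s.2 i < _ then _ else _ : ℕ) : ℤ) = _
  symm
  rw [Int.ceil_eq_iff]
  split_ifs with h
  · push_cast
    exact ⟨by linarith [hU.2], by linarith [hU.1]⟩
  · push_cast
    exact ⟨by linarith [hU.2], by linarith⟩

/-! ## Sums of dithered ceilings -/

/-- Passing from `m` to `m + 1` shifts the sequence of terms by one: the term that leaves is
replaced by one larger by exactly 1. -/
lemma sum_ceil_div_eq {n : ℕ} (hn : 0 < n) (m : ℤ) :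
    ∑ l ∈ Finset.range n, ⌈((m - l : ℤ) : ℝ) / n⌉ = m := by
  have hn' : (0 : ℝ) < n := by exact_mod_cast hn
  have step : ∀ m : ℤ, ∑ l ∈ Finset.range n, ⌈((m + 1 - l : ℤ) : ℝ) / n⌉ =
      ∑ l ∈ Finset.range n, ⌈((m - l : ℤ) : ℝ) / n⌉ + 1 := fun m => by
    have h1 := Finset.sum_range_succ (fun l : ℕ => ⌈((m + 1 - l : ℤ) : ℝ) / n⌉) n
    have h2 := Finset.sum_range_succ' (fun l : ℕ => ⌈((m + 1 - l : ℤ) : ℝ) / n⌉) n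
    have h3 : ⌈((m + 1 - ((0 : ℕ) : ℤ) : ℤ) : ℝ) / n⌉ = ⌈((m + 1 - (n : ℤ) : ℤ) : ℝ) / n⌉ + 1 := by
      rw [← Int.ceil_add_one]
      congr 1
      push_cast
      field_simp
      ring
    have h4 : ∀ l : ℕ, (m + 1 - ((l + 1 : ℕ) : ℤ) : ℤ) = m - l := fun l => by push_cast; ring
    simp only [h4] at h2
    linarith
  induction m using Int.induction_on with
  | zero =>
    refine Finset.sum_eq_zero fun l hl => ?_
    have hl' : (l : ℝ) < n := by exact_mod_cast Finset.mem_range.1 hl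
    rw [Int.ceil_eq_iff]
    push_cast
    constructor
    · rw [lt_div_iff₀ hn']; linarith
    · apply div_nonpos_of_nonpos_of_nonneg _ hn'.le
      have : (0 : ℝ) ≤ l := Nat.cast_nonneg l
      linarith
  | succ i ih => rw [step, ih]
  | pred i ih =>
    have := step (-i - 1)
    rw [show (-(i : ℤ) - 1 + 1) = -i by ring, ih] at this
    linarith

/-- Hermite's identity, for ceilings. -/
lemma sum_ceil_sub_div {n : ℕ} (hn : 0 < n) (v : ℝ) :
    ∑ l : Fin n, ⌈v - (l : ℕ) / n⌉ = ⌈n * v⌉ := by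
  have hn' : (0 : ℝ) < n := by exact_mod_cast hn
  rw [← sum_ceil_div_eq hn ⌈n * v⌉, Fin.sum_univ_eq_sum_range (fun l => ⌈v - (l : ℕ) / n⌉) n]
  refine Finset.sum_congr rfl fun l _ => ?_
  -- The summands agree because both ceilings have the same integer upper bounds: `n v ≤ z n + l` is
  -- equivalent to `⌈n v⌉ ≤ z n + l`.
  refine eq_of_forall_ge_iff fun z => ?_
  rw [Int.ceil_le, Int.ceil_le, div_le_iff₀ hn', sub_le_iff_le_add]
  have h1 : (((⌈n * v⌉ - l : ℤ)) : ℝ) ≤ z * n ↔ ⌈n * v⌉ - l ≤ z * n := by exact_mod_cast Iff.rfl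
  rw [h1, sub_le_iff_le_add, Int.ceil_le]
  push_cast
  constructor <;> intro h
  · have := mul_le_mul_of_nonneg_left h hn'.le
    rw [mul_add, mul_div_cancel₀ _ hn'.ne'] at this
    linarith
  · rw [← sub_nonneg] at h ⊢
    have : z + l / n - v = (z * n + l - n * v) / n := by field_simp
    rw [this]
    exact div_nonneg h hn'.le

/-- The rounding error of a dithered ceiling. -/
def ceilError (v u : ℝ) : ℝ := ⌈v - u⌉ - v

lemma abs_ceilError_le {v u : ℝ} (hu : u ∈ Set.Ico (0 : ℝ) 1) : |ceilError v u| ≤ 1 := by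
  have h1 := Int.le_ceil (v - u)
  have h2 := Int.ceil_lt_add_one (v - u)
  unfold ceilError
  rw [abs_le]
  constructor <;> linarith [hu.1, hu.2]

lemma dither_mem {n : ℕ} {s : Equiv.Perm (Fin n) × (Fin n → ℝ)}
    (hs : ∀ i, s.2 i ∈ Set.Ico (0 : ℝ) (1 / (n : ℝ))) (i : Fin n) :
    dither s i ∈ Set.Ico (0 : ℝ) 1 := by
  have hn : 0 < n := i.pos
  have hn' : (0 : ℝ) < n := by exact_mod_cast hn
  have h1 : (((s.1 i : ℕ) : ℝ) + 1) / n ≤ 1 := by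
    rw [div_le_one hn']
    exact_mod_cast (s.1 i).2
  rw [add_div] at h1
  unfold dither
  exact ⟨add_nonneg (by positivity) (hs i).1, by linarith [(hs i).2]⟩

/-- The dithers occupy each cell `[l/n, (l+1)/n)` once, so monotonicity of the ceiling and Hermite's
identity squeeze the sum of ceilings between `⌈n v - 1⌉` and `⌈n v⌉`. For independent dithers the
sum would fluctuate on the scale `√n` instead. -/
lemma abs_sum_ceilError_le {n : ℕ} {s : Equiv.Perm (Fin n) × (Fin n → ℝ)}
    (hs : ∀ i, s.2 i ∈ Set.Ico (0 : ℝ) (1 / (n : ℝ))) (v : ℝ) :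
    |∑ i, ceilError v (dither s i)| ≤ 1 := by
  rcases Nat.eq_zero_or_pos n with rfl | hn
  · simp
  have hn' : (0 : ℝ) < n := by exact_mod_cast hn
  have hup : ∑ i, ⌈v - dither s i⌉ ≤ ⌈n * v⌉ := by
    rw [← sum_ceil_sub_div hn, ← Equiv.sum_comp s.1 fun l => ⌈v - (l : ℕ) / n⌉]
    refine Finset.sum_le_sum fun i _ => Int.ceil_mono ?_
    unfold dither
    linarith [(hs i).1]
  have hlo : ⌈n * v - 1⌉ ≤ ∑ i, ⌈v - dither s i⌉ := by
    have : (n : ℝ) * v - 1 = n * (v - 1 / n) := by field_simp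
    rw [this, ← sum_ceil_sub_div hn, ← Equiv.sum_comp s.1 fun l => ⌈v - 1 / n - (l : ℕ) / n⌉]
    refine Finset.sum_le_sum fun i _ => Int.ceil_mono ?_
    unfold dither
    linarith [(hs i).2]
  have hsum : ∑ i, ceilError v (dither s i) = ((∑ i, ⌈v - dither s i⌉ : ℤ) : ℝ) - n * v := by
    simp [ceilError, Finset.sum_sub_distrib]
  have h1 : ((∑ i, ⌈v - dither s i⌉ : ℤ) : ℝ) ≤ ⌈n * v⌉ := by exact_mod_cast hup
  have h2 : ((⌈n * v - 1⌉ : ℤ) : ℝ) ≤ ((∑ i, ⌈v - dither s i⌉ : ℤ) : ℝ) := by exact_mod_cast hlo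
  have h3 := Int.ceil_lt_add_one ((n : ℝ) * v)
  have h4 := Int.le_ceil ((n : ℝ) * v - 1)
  rw [hsum, abs_le]
  constructor <;> linarith

/-- The difference of two rounding errors with the same dither takes two values. -/
lemma ceilError_sub_sq (v w u : ℝ) :
    (ceilError w u - ceilError v u) ^ 2 = Int.fract (w - v) * (1 - Int.fract (w - v)) +
      (1 - 2 * Int.fract (w - v)) * (ceilError w u - ceilError v u) := by
  have h1 := Int.le_ceil (v - u)
  have h2 := Int.ceil_lt_add_one (v - u)
  have h3 := Int.le_ceil (w - u)
  have h4 := Int.ceil_lt_add_one (w - u)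
  have h5 := Int.floor_le (w - v)
  have h6 := Int.lt_floor_add_one (w - v)
  have hZ1 : ⌊w - v⌋ < ⌈w - u⌉ - ⌈v - u⌉ + 1 := by
    have : ((⌊w - v⌋ : ℤ) : ℝ) < ((⌈w - u⌉ - ⌈v - u⌉ + 1 : ℤ) : ℝ) := by push_cast; linarith
    exact_mod_cast this
  have hZ2 : ⌈w - u⌉ - ⌈v - u⌉ < ⌊w - v⌋ + 2 := by
    have : ((⌈w - u⌉ - ⌈v - u⌉ : ℤ) : ℝ) < ((⌊w - v⌋ + 2 : ℤ) : ℝ) := by push_cast; linarith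
    exact_mod_cast this
  have hf : Int.fract (w - v) = w - v - ⌊w - v⌋ := rfl
  unfold ceilError
  -- With `f` the fractional part of `w - v`, the difference of errors is `-f` or `1 - f`. Both are
  -- roots of `e² = f(1 - f) + (1 - 2f) e`, whose last term will have mean zero.
  obtain h | h : ⌈w - u⌉ = ⌊w - v⌋ + ⌈v - u⌉ ∨ ⌈w - u⌉ = ⌊w - v⌋ + 1 + ⌈v - u⌉ := by omega
  · rw [h, hf]
    push_cast
    ring
  · rw [h, hf]
    push_cast
    ring

lemma fract_mul_one_sub_fract_le (x : ℝ) : Int.fract x * (1 - Int.fract x) ≤ |x| := by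
  have h0 := Int.fract_nonneg x
  have h1 := (Int.fract_lt_one x).le
  rcases le_or_gt 0 x with hx | hx
  · rw [abs_of_nonneg hx]
    have : Int.fract x ≤ x := by
      have : (0 : ℝ) ≤ ⌊x⌋ := by exact_mod_cast Int.floor_nonneg.2 hx
      unfold Int.fract
      linarith
    nlinarith
  · rw [abs_of_neg hx]
    have : 1 - Int.fract x ≤ -x := by
      have : ((⌊x⌋ : ℤ) : ℝ) ≤ -1 := by
        have : ⌊x⌋ < 0 := Int.floor_lt.2 (by simpa using hx)
        exact_mod_cast Int.le_sub_one_of_lt this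
      unfold Int.fract
      linarith
    nlinarith

/-! ## Sums over random permutations -/

lemma sum_perm_apply {ι : Type*} [Fintype ι] [DecidableEq ι] (f : ι → ℝ) (i : ι) :
    (Fintype.card ι : ℝ) * ∑ π : Equiv.Perm ι, f (π i) =
      Fintype.card (Equiv.Perm ι) * ∑ l, f l := by
  have h : ∀ j, ∑ π : Equiv.Perm ι, f (π j) = ∑ π : Equiv.Perm ι, f (π i) := fun j => by
    rw [← Equiv.sum_comp (Equiv.mulRight (Equiv.swap i j))]
    simp
  calc (Fintype.card ι : ℝ) * ∑ π : Equiv.Perm ι, f (π i)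
      = ∑ j, ∑ π : Equiv.Perm ι, f (π j) := by
        rw [Finset.sum_congr rfl fun j _ => h j]; simp
    _ = ∑ π : Equiv.Perm ι, ∑ l, f l := by
        rw [Finset.sum_comm]
        exact Finset.sum_congr rfl fun π _ => Equiv.sum_comp π f
    _ = _ := by simp

/-- By symmetry every `m ≠ i` may replace `j`, and the sum of `g (π m)` over `m ≠ i` is `-g (π i)`,
because the values of `g` add up to zero. -/
lemma sum_perm_mul_apply {ι : Type*} [Fintype ι] [DecidableEq ι] (f g : ι → ℝ)
    (hg : ∑ l, g l = 0) {i j : ι} (hij : i ≠ j) :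
    ((Fintype.card ι : ℝ) - 1) * ∑ π : Equiv.Perm ι, f (π i) * g (π j) =
      -∑ π : Equiv.Perm ι, f (π i) * g (π i) := by
  have h : ∀ m ∈ Finset.univ.erase i, ∑ π : Equiv.Perm ι, f (π i) * g (π m) =
      ∑ π : Equiv.Perm ι, f (π i) * g (π j) := fun m hm => by
    rw [← Equiv.sum_comp (Equiv.mulRight (Equiv.swap j m))]
    simp [Equiv.swap_apply_of_ne_of_ne hij (Finset.ne_of_mem_erase hm).symm]
  have hcard : ((Finset.univ.erase i).card : ℝ) = (Fintype.card ι : ℝ) - 1 := by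
    rw [Finset.card_erase_of_mem (Finset.mem_univ i), Finset.card_univ,
      Nat.cast_sub (Fintype.card_pos_iff.2 ⟨i⟩), Nat.cast_one]
  calc ((Fintype.card ι : ℝ) - 1) * ∑ π : Equiv.Perm ι, f (π i) * g (π j)
      = ∑ m ∈ Finset.univ.erase i, ∑ π : Equiv.Perm ι, f (π i) * g (π m) := by
        rw [Finset.sum_congr rfl h, Finset.sum_const, nsmul_eq_mul, hcard]
    _ = ∑ π : Equiv.Perm ι, f (π i) * ∑ m ∈ Finset.univ.erase i, g (π m) := by
        rw [Finset.sum_comm]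
        simp_rw [Finset.mul_sum]
    _ = ∑ π : Equiv.Perm ι, f (π i) * -g (π i) := by
        refine Finset.sum_congr rfl fun π _ => ?_
        have := Finset.add_sum_erase Finset.univ (fun m => g (π m)) (Finset.mem_univ i)
        rw [Equiv.sum_comp π g, hg] at this
        rw [show ∑ m ∈ Finset.univ.erase i, g (π m) = -g (π i) by linarith]
    _ = _ := by simp

/-- Second moment of the sum along a random permutation of a matrix whose rows sum to zero. -/
lemma sum_perm_sq_le {ι : Type*} [Fintype ι] [DecidableEq ι] (b : ι → ι → ℝ)
    (hb : ∀ i, ∑ l, b i l = 0) :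
    ∑ π : Equiv.Perm ι, (∑ i, b i (π i)) ^ 2 ≤ 2 * ∑ π : Equiv.Perm ι, ∑ i, b i (π i) ^ 2 := by
  rcases isEmpty_or_nonempty ι with hι | hι
  · simp
  rcases Nat.lt_or_ge 1 (Fintype.card ι) with hcard | hcard
  swap
  -- With one column, a vanishing row sum makes the entry itself zero. The division by `N - 1` below
  -- needs `N ≥ 2`.
  · have hs : Subsingleton ι := Fintype.card_le_one_iff_subsingleton.1 hcard
    have h0 : ∀ i l, b i l = 0 := fun i l => by
      rw [← hb i, Fintype.sum_subsingleton _ l]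
    simp [h0]
  set N : ℝ := ((Fintype.card ι : ℕ) : ℝ) with hN
  have hN2 : (2 : ℝ) ≤ N := by rw [hN]; exact_mod_cast hcard
  set A := ∑ π : Equiv.Perm ι, ∑ i, b i (π i) ^ 2 with hA
  have hA0 : 0 ≤ A := Finset.sum_nonneg fun π _ => Finset.sum_nonneg fun i _ => sq_nonneg _
  set B := ∑ i, ∑ j ∈ Finset.univ.erase i, ∑ π : Equiv.Perm ι, b i (π i) * b j (π j) with hB
  have hsplit : ∑ π : Equiv.Perm ι, (∑ i, b i (π i)) ^ 2 = A + B := by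
    have : ∀ π : Equiv.Perm ι, (∑ i, b i (π i)) ^ 2 = ∑ i, b i (π i) ^ 2 +
        ∑ i, ∑ j ∈ Finset.univ.erase i, b i (π i) * b j (π j) := fun π => by
      rw [sq, Finset.sum_mul_sum, ← Finset.sum_add_distrib]
      refine Finset.sum_congr rfl fun i _ => ?_
      rw [← Finset.add_sum_erase _ _ (Finset.mem_univ i), sq]
    rw [Finset.sum_congr rfl fun π _ => this π, Finset.sum_add_distrib, hA, hB, Finset.sum_comm]
    congr 1
    rw [Finset.sum_comm]
    exact Finset.sum_congr rfl fun i _ => Finset.sum_comm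
  -- The off-diagonal part becomes `∑_l (∑_i b i l ^ 2 - (∑_i b i l)²)`, up to normalisation.
  -- Dropping the negative squares leaves the diagonal part `A`.
  have hBle : (N - 1) * B ≤ A := by
    have h1 : (N - 1) * B =
        ∑ i, ∑ j ∈ Finset.univ.erase i, -∑ π : Equiv.Perm ι, b i (π i) * b j (π i) := by
      rw [hB, Finset.mul_sum]
      refine Finset.sum_congr rfl fun i _ => ?_
      rw [Finset.mul_sum]
      exact Finset.sum_congr rfl fun j hj =>
        sum_perm_mul_apply _ _ (hb j) (Finset.ne_of_mem_erase hj).symm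
    have h2 : ∀ i j, N * ∑ π : Equiv.Perm ι, b i (π i) * b j (π i) =
        Fintype.card (Equiv.Perm ι) * ∑ l, b i l * b j l := fun i j =>
      sum_perm_apply (fun l => b i l * b j l) i
    have h3 : N * ((N - 1) * B) = Fintype.card (Equiv.Perm ι) *
        ∑ l, (∑ i, b i l ^ 2 - (∑ i, b i l) ^ 2) := by
      have h4 : ∀ l, ∑ i, b i l ^ 2 - (∑ i, b i l) ^ 2 =
          -∑ i, ∑ j ∈ Finset.univ.erase i, b i l * b j l := fun l => by
        rw [sq, Finset.sum_mul_sum, ← Finset.sum_sub_distrib, ← Finset.sum_neg_distrib]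
        refine Finset.sum_congr rfl fun i _ => ?_
        rw [← Finset.add_sum_erase _ _ (Finset.mem_univ i)]
        ring
      rw [h1, Finset.sum_congr rfl fun l _ => h4 l, Finset.sum_neg_distrib, Finset.sum_comm,
        mul_neg, Finset.mul_sum, Finset.mul_sum, ← Finset.sum_neg_distrib]
      refine Finset.sum_congr rfl fun i _ => ?_
      rw [Finset.sum_comm, Finset.mul_sum, Finset.mul_sum, ← Finset.sum_neg_distrib]
      refine Finset.sum_congr rfl fun j _ => ?_
      rw [mul_neg, h2]
    have h5 : N * A = Fintype.card (Equiv.Perm ι) * ∑ l, ∑ i, b i l ^ 2 := by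
      rw [hA, Finset.sum_comm, Finset.mul_sum,
        Finset.sum_congr rfl fun i _ => sum_perm_apply (fun l => b i l ^ 2) i, ← Finset.mul_sum,
        Finset.sum_comm]
    have h6 : N * ((N - 1) * B) ≤ N * A := by
      rw [h3, h5]
      refine mul_le_mul_of_nonneg_left (Finset.sum_le_sum fun l _ => ?_) (Nat.cast_nonneg _)
      linarith [sq_nonneg (∑ i, b i l)]
    exact le_of_mul_le_mul_left h6 (by linarith)
  rw [hsplit]
  rcases le_or_gt B 0 with h | h <;> nlinarith

/-! ## Moments of the one-dimensional rounding errors -/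

instance (n : ℕ) : DiscreteMeasurableSpace (Equiv.Perm (Fin n)) := ⟨fun _ => trivial⟩

/-- Law of the offset `γ i` of one client. -/
def offsetLaw (n : ℕ) : Measure ℝ := cond volume (Set.Ico (0 : ℝ) (1 / (n : ℝ)))

/-- Law of the permutation and the offsets of one coordinate. -/
def ditherLaw (n : ℕ) : Measure (Equiv.Perm (Fin n) × (Fin n → ℝ)) :=
  (PMF.uniformOfFintype (Equiv.Perm (Fin n))).toMeasure.prod
    (Measure.pi fun _ : Fin n => offsetLaw n)

lemma isProbabilityMeasure_offsetLaw {n : ℕ} (hn : 0 < n) :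
    IsProbabilityMeasure (offsetLaw n) := by
  have hn' : (0 : ℝ) < n := by exact_mod_cast hn
  refine cond_isProbabilityMeasure_of_finite ?_ ?_
  · simp [hn]
  · simp

lemma isProbabilityMeasure_ditherLaw {n : ℕ} (hn : 0 < n) :
    IsProbabilityMeasure (ditherLaw n) := by
  have := isProbabilityMeasure_offsetLaw hn
  unfold ditherLaw
  infer_instance

lemma ae_offsetLaw_mem (n : ℕ) : ∀ᵐ γ ∂offsetLaw n, γ ∈ Set.Ico (0 : ℝ) (1 / (n : ℝ)) :=
  ae_cond_mem measurableSet_Ico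

lemma ae_pi_offsetLaw_mem {n : ℕ} (hn : 0 < n) :
    ∀ᵐ γ ∂Measure.pi fun _ : Fin n => offsetLaw n, ∀ i, γ i ∈ Set.Ico (0 : ℝ) (1 / (n : ℝ)) := by
  have := isProbabilityMeasure_offsetLaw hn
  rw [ae_all_iff]
  exact fun i => (measurePreserving_eval (fun _ : Fin n => offsetLaw n) i).quasiMeasurePreserving.ae
    (ae_offsetLaw_mem n)

lemma ae_ditherLaw_mem {n : ℕ} (hn : 0 < n) :
    ∀ᵐ s ∂ditherLaw n, ∀ i, s.2 i ∈ Set.Ico (0 : ℝ) (1 / (n : ℝ)) := by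
  have := isProbabilityMeasure_offsetLaw hn
  exact Measure.quasiMeasurePreserving_snd.ae (ae_pi_offsetLaw_mem hn)

lemma integral_offsetLaw {n : ℕ} (hn : 0 < n) (f : ℝ → ℝ) :
    ∫ γ, f γ ∂offsetLaw n = n * ∫ γ in (0 : ℝ)..1 / n, f γ := by
  have hn' : (0 : ℝ) < n := by exact_mod_cast hn
  rw [intervalIntegral.integral_of_le (by positivity), ← integral_Ico_eq_integral_Ioc, offsetLaw,
    ProbabilityTheory.cond, integral_smul_measure, smul_eq_mul]
  simp [hn'.le]

/-- The integrand is `⌈a⌉` on `(0, f)` and `⌈a⌉ - 1` on `(f, 1)`, where `f = a - ⌈a⌉ + 1`. The break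
points form a null set. -/
lemma integral_ceil_sub (a : ℝ) : ∫ u in (0 : ℝ)..1, ((⌈a - u⌉ : ℤ) : ℝ) = a := by
  set m := ⌈a⌉ - 1 with hm
  have h1 := Int.le_ceil a
  have h2 := Int.ceil_lt_add_one a
  have hmr : (m : ℝ) = ⌈a⌉ - 1 := by rw [hm]; push_cast; ring
  set f := a - m with hf
  have hf0 : 0 < f := by linarith
  have hf1 : f ≤ 1 := by linarith
  have e1 : Set.EqOn (fun u => ((⌈a - u⌉ : ℤ) : ℝ)) (fun _ => (m : ℝ) + 1) (Set.Ioo 0 f) := by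
    intro u hu
    have : ⌈a - u⌉ = m + 1 := by
      rw [Int.ceil_eq_iff]; push_cast; constructor <;> linarith [hu.1, hu.2]
    simp [this]
  have e2 : Set.EqOn (fun u => ((⌈a - u⌉ : ℤ) : ℝ)) (fun _ => (m : ℝ)) (Set.Ioo f 1) := by
    intro u hu
    have : ⌈a - u⌉ = m := by
      rw [Int.ceil_eq_iff]; constructor <;> linarith [hu.1, hu.2]
    simp [this]
  have a1 : (fun u => ((⌈a - u⌉ : ℤ) : ℝ)) =ᵐ[volume.restrict (Set.uIoc 0 f)]
      fun _ => (m : ℝ) + 1 := by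
    rw [Set.uIoc_of_le hf0.le, ← restrict_Ioo_eq_restrict_Ioc]
    exact (ae_restrict_mem measurableSet_Ioo).mono fun u hu => e1 hu
  have a2 : (fun u => ((⌈a - u⌉ : ℤ) : ℝ)) =ᵐ[volume.restrict (Set.uIoc f 1)]
      fun _ => (m : ℝ) := by
    rw [Set.uIoc_of_le hf1, ← restrict_Ioo_eq_restrict_Ioc]
    exact (ae_restrict_mem measurableSet_Ioo).mono fun u hu => e2 hu
  have i1 : IntervalIntegrable (fun u => ((⌈a - u⌉ : ℤ) : ℝ)) volume 0 f :=
    (intervalIntegrable_const (c := (m : ℝ) + 1)).congr_ae a1.symm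
  have i2 : IntervalIntegrable (fun u => ((⌈a - u⌉ : ℤ) : ℝ)) volume f 1 :=
    (intervalIntegrable_const (c := (m : ℝ))).congr_ae a2.symm
  rw [← intervalIntegral.integral_add_adjacent_intervals i1 i2,
    intervalIntegral.integral_congr_ae_restrict a1, intervalIntegral.integral_congr_ae_restrict a2]
  simp only [intervalIntegral.integral_const, smul_eq_mul]
  rw [hf]
  ring

lemma measurable_ceilError_right (v : ℝ) : Measurable (ceilError v) :=
  ((measurable_of_countable fun z : ℤ => (z : ℝ)).comp
    (Int.measurable_ceil.comp (measurable_const.sub measurable_id))).sub measurable_const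

lemma cell_add_mem {n : ℕ} (l : Fin n) {γ : ℝ} (hγ : γ ∈ Set.Ico (0 : ℝ) (1 / (n : ℝ))) :
    ((l : ℕ) : ℝ) / n + γ ∈ Set.Ico (0 : ℝ) 1 :=
  dither_mem (s := (1, fun _ => γ)) (fun _ => hγ) l

lemma integrable_ceilError_cell {n : ℕ} (hn : 0 < n) (v : ℝ) (l : Fin n) :
    Integrable (fun γ => ceilError v ((l : ℕ) / n + γ)) (offsetLaw n) := by
  have := isProbabilityMeasure_offsetLaw hn
  refine Integrable.of_bound ((measurable_ceilError_right v).comp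
    (measurable_const.add measurable_id)).aestronglyMeasurable 1 ?_
  filter_upwards [ae_offsetLaw_mem n] with γ hγ
  exact abs_ceilError_le (cell_add_mem l hγ)

/-- Hermite's identity turns the sum over the cells into `⌈n v - n γ⌉ - n v`, where `n γ` is uniform
on `[0, 1)`. This gives unbiasedness, and also the zero row sums required by `sum_perm_sq_le`. -/
lemma sum_integral_ceilError_cell {n : ℕ} (hn : 0 < n) (v : ℝ) :
    ∑ l : Fin n, ∫ γ, ceilError v ((l : ℕ) / n + γ) ∂offsetLaw n = 0 := by
  have hn' : (n : ℝ) ≠ 0 := by exact_mod_cast hn.ne'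
  have := isProbabilityMeasure_offsetLaw hn
  rw [← integral_finsetSum _ fun l _ => integrable_ceilError_cell hn v l]
  have h : ∀ γ : ℝ, ∑ l : Fin n, ceilError v ((l : ℕ) / n + γ) =
      ((⌈n * v - n * γ⌉ : ℤ) : ℝ) - n * v := fun γ => by
    rw [← mul_sub, ← sum_ceil_sub_div hn]
    simp only [ceilError, Finset.sum_sub_distrib, Int.cast_sum, Finset.sum_const,
      Finset.card_univ, Fintype.card_fin, nsmul_eq_mul]
    congr 1
    refine Finset.sum_congr rfl fun l _ => ?_
    congr 2
    ring
  have hint : Integrable (fun γ => ((⌈n * v - n * γ⌉ : ℤ) : ℝ) - n * v) (offsetLaw n) :=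
    (integrable_finsetSum _ fun l _ => integrable_ceilError_cell hn v l).congr
      (Filter.Eventually.of_forall h)
  have hint' : Integrable (fun γ => ((⌈n * v - n * γ⌉ : ℤ) : ℝ)) (offsetLaw n) := by
    refine (hint.add (integrable_const ((n : ℝ) * v))).congr (Filter.Eventually.of_forall ?_)
    intro γ
    simp
  simp only [h]
  rw [integral_sub hint' (integrable_const _), integral_offsetLaw hn,
    intervalIntegral.integral_comp_mul_left (fun u => ((⌈n * v - u⌉ : ℤ) : ℝ)) hn']
  simp only [mul_zero, mul_one_div_cancel hn', integral_ceil_sub, smul_eq_mul, integral_const,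
    probReal_univ, one_mul]
  field_simp
  ring

lemma integral_ditherLaw {n : ℕ} (hn : 0 < n) {f : Equiv.Perm (Fin n) × (Fin n → ℝ) → ℝ}
    (hf : Integrable f (ditherLaw n)) :
    ∫ s, f s ∂ditherLaw n = (Fintype.card (Equiv.Perm (Fin n)) : ℝ)⁻¹ *
      ∑ π, ∫ γ, f (π, γ) ∂Measure.pi fun _ : Fin n => offsetLaw n := by
  have := isProbabilityMeasure_offsetLaw hn
  unfold ditherLaw at hf ⊢
  rw [integral_prod _ hf, PMF.integral_eq_sum, Finset.mul_sum]
  refine Finset.sum_congr rfl fun π _ => ?_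
  simp

lemma measurable_dither {n : ℕ} (i : Fin n) :
    Measurable fun s : Equiv.Perm (Fin n) × (Fin n → ℝ) => dither s i := by
  unfold dither
  exact (((measurable_of_countable fun π : Equiv.Perm (Fin n) => ((π i : ℕ) : ℝ)).comp
    measurable_fst).div_const _).add ((measurable_pi_apply i).comp measurable_snd)

lemma measurable_ceilError_dither {n : ℕ} (v : ℝ) (i : Fin n) :
    Measurable fun s : Equiv.Perm (Fin n) × (Fin n → ℝ) => ceilError v (dither s i) :=
  (measurable_ceilError_right v).comp (measurable_dither i)

lemma integrable_ceilError {n : ℕ} (hn : 0 < n) (v : ℝ) (i : Fin n) :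
    Integrable (fun s => ceilError v (dither s i)) (ditherLaw n) := by
  have := isProbabilityMeasure_ditherLaw hn
  refine Integrable.of_bound (measurable_ceilError_dither v i).aestronglyMeasurable 1 ?_
  filter_upwards [ae_ditherLaw_mem hn] with s hs
  exact abs_ceilError_le (dither_mem hs i)

lemma average_perm_apply {n : ℕ} (hn : 0 < n) (f : Fin n → ℝ) (i : Fin n) :
    (Fintype.card (Equiv.Perm (Fin n)) : ℝ)⁻¹ * ∑ π : Equiv.Perm (Fin n), f (π i) =
      (n : ℝ)⁻¹ * ∑ l, f l := by
  have h := sum_perm_apply f i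
  rw [Fintype.card_fin] at h
  have hn' : (n : ℝ) ≠ 0 := by exact_mod_cast hn.ne'
  have hc : (Fintype.card (Equiv.Perm (Fin n)) : ℝ) ≠ 0 := by
    exact_mod_cast Fintype.card_ne_zero
  field_simp
  linarith

/-- Dithered ceilings are unbiased. -/
lemma integral_ceilError {n : ℕ} (hn : 0 < n) (v : ℝ) (i : Fin n) :
    ∫ s, ceilError v (dither s i) ∂ditherLaw n = 0 := by
  have := isProbabilityMeasure_offsetLaw hn
  rw [integral_ditherLaw hn (integrable_ceilError hn v i)]
  have h : ∀ π : Equiv.Perm (Fin n), ∫ γ, ceilError v (dither (π, γ) i)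
      ∂(Measure.pi fun _ : Fin n => offsetLaw n) =
      ∫ γ, ceilError v ((π i : ℕ) / n + γ) ∂offsetLaw n := fun π =>
    integral_comp_eval (μ := fun _ : Fin n => offsetLaw n) (i := i)
      (f := fun γ => ceilError v ((π i : ℕ) / n + γ))
      (integrable_ceilError_cell hn v (π i)).aestronglyMeasurable
  simp only [h]
  rw [average_perm_apply hn (fun l => ∫ γ, ceilError v ((l : ℕ) / n + γ) ∂offsetLaw n),
    sum_integral_ceilError_cell hn, mul_zero]

/-- Second moment of a sum of independent variables. -/
lemma integral_sum_sq_pi_le {ι : Type*} [Fintype ι] {Ω : Type*} [MeasurableSpace Ω]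
    {μ : Measure Ω} [IsProbabilityMeasure μ] {X : ι → Ω → ℝ} (hX : ∀ i, MemLp (X i) 2 μ) :
    ∫ ω, (∑ i, X i (ω i)) ^ 2 ∂Measure.pi (fun _ : ι => μ) ≤
      ∑ i, ∫ x, X i x ^ 2 ∂μ + (∑ i, ∫ x, X i x ∂μ) ^ 2 := by
  have hmp := fun i => measurePreserving_eval (fun _ : ι => μ) i
  have hXi : ∀ i, MemLp (fun ω : ι → Ω => X i (ω i)) 2 (Measure.pi fun _ : ι => μ) := fun i =>
    (hX i).comp_measurePreserving (hmp i)
  have hS : MemLp (∑ i, fun ω : ι → Ω => X i (ω i)) 2 (Measure.pi fun _ : ι => μ) :=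
    memLp_finsetSum' _ fun i _ => hXi i
  have h1 := variance_sum_pi (μ := fun _ : ι => μ) (X := X) hX
  have h2 := variance_eq_sub hS
  have h3 : ∫ ω, (∑ i, fun ω : ι → Ω => X i (ω i)) ω ∂Measure.pi (fun _ : ι => μ) =
      ∑ i, ∫ x, X i x ∂μ := by
    simp only [Finset.sum_apply]
    rw [integral_finsetSum _ fun i _ => (hXi i).integrable one_le_two]
    exact Finset.sum_congr rfl fun i _ =>
      integral_comp_eval (μ := fun _ : ι => μ) (hX i).aestronglyMeasurable
  have h4 : ∑ i, Var[X i; μ] ≤ ∑ i, ∫ x, X i x ^ 2 ∂μ :=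
    Finset.sum_le_sum fun i _ => variance_le_expectation_sq (hX i).aestronglyMeasurable
  have h5 : ∫ ω, (∑ i, X i (ω i)) ^ 2 ∂Measure.pi (fun _ : ι => μ) =
      ∫ ω, ((∑ i, fun ω : ι → Ω => X i (ω i)) ^ 2) ω ∂Measure.pi (fun _ : ι => μ) := by
    simp
  rw [h5]
  rw [h3] at h2
  linarith

lemma integrable_sq_of_abs_le {Ω : Type*} [MeasurableSpace Ω] {μ : Measure Ω} [IsFiniteMeasure μ]
    {f : Ω → ℝ} (hf : AEStronglyMeasurable f μ) {C : ℝ} (hC : ∀ᵐ x ∂μ, |f x| ≤ C) :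
    Integrable (fun x => f x ^ 2) μ := by
  refine Integrable.of_bound (hf.pow 2) (C ^ 2) ?_
  filter_upwards [hC] with x hx
  rw [Real.norm_eq_abs, abs_pow]
  exact pow_le_pow_left₀ (abs_nonneg _) hx 2

/-- Given `π`, the differences are independent with means `b i (π i)` and second moments `q i (π
i)`. The variances contribute one `∑ q`; the squared sum of the means contributes two after
averaging over `π`, since `b² ≤ q`. This is the factor 3. -/
lemma integral_sum_ceilError_sub_sq_le {n : ℕ} (hn : 0 < n) (w : Fin n → ℝ) (v : ℝ) :
    ∫ s, (∑ i, (ceilError (w i) (dither s i) - ceilError v (dither s i))) ^ 2 ∂ditherLaw n ≤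
      3 * ∑ i, |w i - v| := by
  have := isProbabilityMeasure_offsetLaw hn
  have := isProbabilityMeasure_ditherLaw hn
  set z : Fin n → ℝ → ℝ := fun i u => ceilError (w i) u - ceilError v u with hz
  have hzm : ∀ i, Measurable (z i) := fun i =>
    (measurable_ceilError_right _).sub (measurable_ceilError_right _)
  have hzb : ∀ i, ∀ u ∈ Set.Ico (0 : ℝ) 1, |z i u| ≤ 2 := fun i u hu => by
    have h1 := abs_le.1 (abs_ceilError_le (v := w i) hu)
    have h2 := abs_le.1 (abs_ceilError_le (v := v) hu)
    rw [abs_le]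
    constructor <;> simp only [hz] <;> linarith [h1.1, h1.2, h2.1, h2.2]
  have hcell : ∀ i (l : Fin n), MemLp (fun γ => z i ((l : ℕ) / n + γ)) 2 (offsetLaw n) :=
    fun i l => by
      refine MemLp.of_bound ((hzm i).comp
        (measurable_const.add measurable_id)).aestronglyMeasurable 2 ?_
      filter_upwards [ae_offsetLaw_mem n] with γ hγ
      exact hzb i _ (cell_add_mem l hγ)
  set b : Fin n → Fin n → ℝ := fun i l => ∫ γ, z i ((l : ℕ) / n + γ) ∂offsetLaw n with hb
  set q : Fin n → Fin n → ℝ := fun i l => ∫ γ, z i ((l : ℕ) / n + γ) ^ 2 ∂offsetLaw n with hq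
  have hb0 : ∀ i, ∑ l, b i l = 0 := fun i => by
    have : ∀ l : Fin n, b i l = ∫ γ, ceilError (w i) ((l : ℕ) / n + γ) ∂offsetLaw n -
        ∫ γ, ceilError v ((l : ℕ) / n + γ) ∂offsetLaw n := fun l =>
      integral_sub (integrable_ceilError_cell hn _ l) (integrable_ceilError_cell hn _ l)
    rw [Finset.sum_congr rfl fun l _ => this l, Finset.sum_sub_distrib,
      sum_integral_ceilError_cell hn, sum_integral_ceilError_cell hn, sub_zero]
  have hbq : ∀ i l, b i l ^ 2 ≤ q i l := fun i l => by
    have h := variance_eq_sub (hcell i l)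
    have h0 := variance_nonneg (fun γ => z i ((l : ℕ) / n + γ)) (offsetLaw n)
    have : q i l = ∫ γ, ((fun γ => z i ((l : ℕ) / n + γ)) ^ 2) γ ∂offsetLaw n := by simp [hq]
    rw [← this] at h
    linarith
  have hqsum : ∀ i, (n : ℝ)⁻¹ * ∑ l, q i l ≤ |w i - v| := fun i => by
    set φ := Int.fract (w i - v)
    -- By `ceilError_sub_sq`, `q` is affine in `b`. The average of `q` over the cells is therefore
    -- `φ(1 - φ)`, because the `b i l` cancel.
    have hql : ∀ l, q i l = φ * (1 - φ) + (1 - 2 * φ) * b i l := fun l => by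
      have h : ∀ γ, z i ((l : ℕ) / n + γ) ^ 2 =
          φ * (1 - φ) + (1 - 2 * φ) * z i ((l : ℕ) / n + γ) := fun γ => ceilError_sub_sq _ _ _
      simp only [hq, h]
      rw [integral_add (integrable_const _)
        (((hcell i l).integrable one_le_two).const_mul _),
        integral_const_mul (1 - 2 * φ) (fun γ => z i ((l : ℕ) / n + γ))]
      simp [hb]
    have hn' : (n : ℝ) ≠ 0 := by exact_mod_cast hn.ne'
    rw [Finset.sum_congr rfl fun l _ => hql l, Finset.sum_add_distrib,
      ← Finset.mul_sum Finset.univ (fun l => b i l), hb0]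
    simp only [Finset.sum_const, Finset.card_univ, Fintype.card_fin, nsmul_eq_mul, mul_zero,
      add_zero]
    rw [inv_mul_cancel_left₀ hn']
    exact fract_mul_one_sub_fract_le _
  have hint : Integrable (fun s => (∑ i, z i (dither s i)) ^ 2) (ditherLaw n) := by
    refine integrable_sq_of_abs_le (Finset.measurable_sum _ fun i _ =>
      (hzm i).comp (measurable_dither i)).aestronglyMeasurable (C := ∑ _i : Fin n, 2) ?_
    filter_upwards [ae_ditherLaw_mem hn] with s hs
    exact (Finset.abs_sum_le_sum_abs _ _).trans
      (Finset.sum_le_sum fun i _ => hzb i _ (dither_mem hs i))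
  rw [integral_ditherLaw hn hint]
  have hπ : ∀ π : Equiv.Perm (Fin n), ∫ γ, (∑ i, z i (dither (π, γ) i)) ^ 2
      ∂(Measure.pi fun _ : Fin n => offsetLaw n) ≤ ∑ i, q i (π i) + (∑ i, b i (π i)) ^ 2 :=
    fun π => integral_sum_sq_pi_le (X := fun i γ => z i ((π i : ℕ) / n + γ))
      fun i => hcell i (π i)
  have hc : 0 ≤ (Fintype.card (Equiv.Perm (Fin n)) : ℝ)⁻¹ := by positivity
  have hbound : ∑ π : Equiv.Perm (Fin n), ∫ γ, (∑ i, z i (dither (π, γ) i)) ^ 2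
      ∂(Measure.pi fun _ : Fin n => offsetLaw n) ≤ 3 * ∑ π : Equiv.Perm (Fin n), ∑ i, q i (π i) := by
    calc _ ≤ ∑ π : Equiv.Perm (Fin n), (∑ i, q i (π i) + (∑ i, b i (π i)) ^ 2) :=
          Finset.sum_le_sum fun π _ => hπ π
      _ = ∑ π : Equiv.Perm (Fin n), ∑ i, q i (π i) +
          ∑ π : Equiv.Perm (Fin n), (∑ i, b i (π i)) ^ 2 := Finset.sum_add_distrib
      _ ≤ ∑ π : Equiv.Perm (Fin n), ∑ i, q i (π i) +
          2 * ∑ π : Equiv.Perm (Fin n), ∑ i, b i (π i) ^ 2 := by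
          gcongr
          exact sum_perm_sq_le b hb0
      _ ≤ ∑ π : Equiv.Perm (Fin n), ∑ i, q i (π i) +
          2 * ∑ π : Equiv.Perm (Fin n), ∑ i, q i (π i) := by
          gcongr
          exact hbq _ _
      _ = _ := by ring
  have havg : (Fintype.card (Equiv.Perm (Fin n)) : ℝ)⁻¹ *
      ∑ π : Equiv.Perm (Fin n), ∑ i, q i (π i) ≤ ∑ i, |w i - v| := by
    rw [Finset.sum_comm, Finset.mul_sum]
    exact Finset.sum_le_sum fun i _ => (average_perm_apply hn (q i) i).trans_le (hqsum i)
  calc _ ≤ _ := mul_le_mul_of_nonneg_left hbound hc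
    _ = 3 * ((Fintype.card (Equiv.Perm (Fin n)) : ℝ)⁻¹ *
          ∑ π : Equiv.Perm (Fin n), ∑ i, q i (π i)) := by ring
    _ ≤ _ := by gcongr

/-- Second moment of the total rounding error of `n` correlated dithered ceilings. -/
lemma integral_sum_ceilError_sq_le {n : ℕ} (hn : 0 < n) (w : Fin n → ℝ) (v : ℝ) :
    ∫ s, (∑ i, ceilError (w i) (dither s i)) ^ 2 ∂ditherLaw n ≤ 2 + 6 * ∑ i, |w i - v| := by
  have := isProbabilityMeasure_ditherLaw hn
  set X := fun s => ∑ i, ceilError (w i) (dither s i)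
  set Y := fun s : Equiv.Perm (Fin n) × (Fin n → ℝ) => ∑ i, ceilError v (dither s i)
  have hX : Measurable X := Finset.measurable_sum _ fun i _ => measurable_ceilError_dither _ i
  have hY : Measurable Y := Finset.measurable_sum _ fun i _ => measurable_ceilError_dither _ i
  have hXb : ∀ᵐ s ∂ditherLaw n, |X s| ≤ ∑ _i : Fin n, 1 := by
    filter_upwards [ae_ditherLaw_mem hn] with s hs
    exact (Finset.abs_sum_le_sum_abs _ _).trans
      (Finset.sum_le_sum fun i _ => abs_ceilError_le (dither_mem hs i))
  have hYb : ∀ᵐ s ∂ditherLaw n, |Y s| ≤ 1 := by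
    filter_upwards [ae_ditherLaw_mem hn] with s hs
    exact abs_sum_ceilError_le hs v
  have hXYb : ∀ᵐ s ∂ditherLaw n, |X s - Y s| ≤ ∑ _i : Fin n, 1 + 1 := by
    filter_upwards [hXb, hYb] with s h1 h2
    exact (abs_sub _ _).trans (add_le_add h1 h2)
  have hiX := integrable_sq_of_abs_le hX.aestronglyMeasurable hXb
  have hiXY : Integrable (fun s => (X s - Y s) ^ 2) (ditherLaw n) :=
    integrable_sq_of_abs_le (hX.sub hY).aestronglyMeasurable hXYb
  have h := integral_sum_ceilError_sub_sq_le hn w v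
  simp only [Finset.sum_sub_distrib] at h
  calc ∫ s, X s ^ 2 ∂ditherLaw n ≤ ∫ s, (2 + 2 * (X s - Y s) ^ 2) ∂ditherLaw n := by
        refine integral_mono_ae hiX ((integrable_const _).add (hiXY.const_mul 2)) ?_
        filter_upwards [hYb] with s hs
        have : Y s ^ 2 ≤ 1 := by rwa [sq_le_one_iff_abs_le_one]
        -- The square is the exact gap in `X² ≤ 2Y² + 2(X - Y)²`.
        nlinarith [sq_nonneg (X s - 2 * Y s)]
    _ = 2 + 2 * ∫ s, (X s - Y s) ^ 2 ∂ditherLaw n := by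
        rw [integral_add (integrable_const _) (hiXY.const_mul 2), integral_const_mul]
        simp
    _ ≤ _ := by linarith

/-! ## The estimate of one coordinate -/

lemma two_le_numLevels (d : ℕ) : 2 ≤ numLevels d := le_max_left _ _

lemma sqrt_le_numLevels (d : ℕ) : Real.sqrt d ≤ numLevels d :=
  (Nat.le_ceil _).trans (by exact_mod_cast le_max_right _ _)

lemma numLevels_le {d : ℕ} (hd : 0 < d) : (numLevels d : ℝ) ≤ Real.sqrt d + 1 := by
  have h1 : (1 : ℝ) ≤ Real.sqrt d := Real.one_le_sqrt.2 (by exact_mod_cast hd)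
  have h2 := (Nat.ceil_lt_add_one (Real.sqrt_nonneg (d : ℝ))).le
  unfold numLevels
  rw [Nat.cast_max]
  exact max_le (by push_cast; linarith) h2

/-- Law of the first level. -/
def firstLevelLaw (k : ℕ) : Measure ℝ := cond volume (Set.Ico (-(1 / (k : ℝ))) 0)

lemma isProbabilityMeasure_firstLevelLaw {k : ℕ} (hk : 0 < k) :
    IsProbabilityMeasure (firstLevelLaw k) := by
  have hk' : (0 : ℝ) < k := by exact_mod_cast hk
  refine cond_isProbabilityMeasure_of_finite ?_ ?_
  · simp [hk]
  · simp

lemma ae_firstLevelLaw_mem (k : ℕ) :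
    ∀ᵐ c ∂firstLevelLaw k, c ∈ Set.Ico (-(1 / (k : ℝ))) 0 :=
  ae_cond_mem measurableSet_Ico

lemma coordLaw_eq (n k : ℕ) : coordLaw n k = (firstLevelLaw k).prod (ditherLaw n) := rfl

lemma isProbabilityMeasure_coordLaw {n k : ℕ} (hn : 0 < n) (hk : 0 < k) :
    IsProbabilityMeasure (coordLaw n k) := by
  have := isProbabilityMeasure_ditherLaw hn
  have := isProbabilityMeasure_firstLevelLaw hk
  rw [coordLaw_eq]
  infer_instance

/-- The almost sure range of the randomness of one coordinate. -/
def IsGoodSeed (k : ℕ) {n : ℕ} (s : CoordSeed n) : Prop :=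
  s.1 ∈ Set.Ico (-(1 / (k : ℝ))) 0 ∧ ∀ i, s.2.2 i ∈ Set.Ico (0 : ℝ) (1 / (n : ℝ))

lemma ae_isGoodSeed {n k : ℕ} (hn : 0 < n) : ∀ᵐ s ∂coordLaw n k, IsGoodSeed k s := by
  have := isProbabilityMeasure_ditherLaw hn
  rw [coordLaw_eq]
  have h1 := Measure.quasiMeasurePreserving_fst (μ := firstLevelLaw k) (ν := ditherLaw n) |>.ae
    (ae_firstLevelLaw_mem k)
  have h2 := Measure.quasiMeasurePreserving_snd (μ := firstLevelLaw k) (ν := ditherLaw n) |>.ae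
    (ae_ditherLaw_mem hn)
  filter_upwards [h1, h2] with s hs1 hs2 using ⟨hs1, hs2⟩

lemma rescale_mem {R x : ℝ} (hR : 0 < R) (hx : |x| ≤ R) :
    (x - -R) / (R - -R) ∈ Set.Icc (0 : ℝ) 1 := by
  have := abs_le.1 hx
  constructor
  · exact div_nonneg (by linarith) (by linarith)
  · rw [div_le_one (by linarith)]
    linarith

/-- In the rescaled variable, `c₁ + m β` with `m = ⌈v - U⌉` equals `y + β (m - v)`; scaling back
multiplies the error by `2R`. -/
lemma levelValue_levelIndex {k : ℕ} (hk : 2 ≤ k) {R x : ℝ} (hR : 0 < R) (hx : |x| ≤ R) {n : ℕ}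
    {s : CoordSeed n} (hs : IsGoodSeed k s) (i : Fin n) :
    levelValue k (-R) R s.1 (levelIndex k (-R) R s i x) = x + 2 * R * spacing k *
      ceilError (((x - -R) / (R - -R) - s.1) / spacing k) (dither s.2 i) := by
  have hβ := (spacing_pos hk).ne'
  have h := levelIndex_eq_ceil hk hs.1 (dither_mem hs.2 i) (rescale_mem hR hx)
  have h' : ((levelIndex k (-R) R s i x : ℕ) : ℝ) =
      ⌈((x - -R) / (R - -R) - s.1) / spacing k - dither s.2 i⌉ := by exact_mod_cast h
  have hR' : R - -R ≠ 0 := by linarith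
  unfold levelValue ceilError
  rw [h']
  field_simp
  ring

/-- The error of the estimate of the mean of one coordinate. -/
def coordError (k : ℕ) (R : ℝ) {n : ℕ} (s : CoordSeed n) (x : Fin n → ℝ) : ℝ :=
  1 / (n : ℝ) * ∑ i, (levelValue k (-R) R s.1 (levelIndex k (-R) R s i (x i)) - x i)

lemma measurable_lowerIndex (k : ℕ) : Measurable fun p : ℝ × ℝ => lowerIndex k p.1 p.2 := by
  -- The number of levels searched is decoupled from the `k` in the spacing, so that induction adds
  -- one level at a time.
  have h : ∀ m, Measurable fun p : ℝ × ℝ =>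
      ((Finset.range m).filter fun j : ℕ => p.1 + j * spacing k < p.2).sup id := fun m => by
    induction m with
    | zero => simp
    | succ m ih =>
      have : ∀ p : ℝ × ℝ,
          ((Finset.range (m + 1)).filter fun j : ℕ => p.1 + j * spacing k < p.2).sup id =
          if p.1 + m * spacing k < p.2 then
            max m (((Finset.range m).filter fun j : ℕ => p.1 + j * spacing k < p.2).sup id)
          else ((Finset.range m).filter fun j : ℕ => p.1 + j * spacing k < p.2).sup id := fun p => by
        rw [Finset.range_add_one, Finset.filter_insert]
        split_ifs
        · rw [Finset.sup_insert]
          rfl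
        · rfl
      simp only [this]
      exact Measurable.ite (measurableSet_lt (measurable_fst.add_const _) measurable_snd)
        (measurable_const.max ih) ih
  exact h k

lemma measurable_levelIndex (k : ℕ) (l r : ℝ) {n : ℕ} (i : Fin n) :
    Measurable fun p : CoordSeed n × ℝ => levelIndex k l r p.1 i p.2 := by
  have hy : Measurable fun p : CoordSeed n × ℝ => (p.2 - l) / (r - l) :=
    (measurable_snd.sub_const _).div_const _
  have hc : Measurable fun p : CoordSeed n × ℝ => p.1.1 := measurable_fst.fst
  have hm : Measurable fun p : CoordSeed n × ℝ => lowerIndex k p.1.1 ((p.2 - l) / (r - l)) :=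
    (measurable_lowerIndex k).comp (hc.prodMk hy)
  have hm' : Measurable fun p : CoordSeed n × ℝ =>
      ((lowerIndex k p.1.1 ((p.2 - l) / (r - l)) : ℕ) : ℝ) :=
    (measurable_of_countable fun m : ℕ => (m : ℝ)).comp hm
  have hU : Measurable fun p : CoordSeed n × ℝ => dither p.1.2 i :=
    (measurable_dither i).comp measurable_fst.snd
  unfold levelIndex
  exact Measurable.ite (measurableSet_lt hU ((hy.sub (hc.add (hm'.mul_const _))).div_const _))
    (hm.add_const 1) hm

lemma measurable_coordError (k : ℕ) (R : ℝ) (n : ℕ) :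
    Measurable fun p : CoordSeed n × (Fin n → ℝ) => coordError k R p.1 p.2 := by
  have hc : Measurable fun p : CoordSeed n × (Fin n → ℝ) => p.1.1 := measurable_fst.fst
  have hi : ∀ i, Measurable fun p : CoordSeed n × (Fin n → ℝ) =>
      levelValue k (-R) R p.1.1 (levelIndex k (-R) R p.1 i (p.2 i)) - p.2 i := fun i => by
    have hx : Measurable fun p : CoordSeed n × (Fin n → ℝ) => p.2 i :=
      measurable_snd.eval
    have hm : Measurable fun p : CoordSeed n × (Fin n → ℝ) =>
        levelIndex k (-R) R p.1 i (p.2 i) := by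
      have := (measurable_levelIndex k (-R) R i).comp (measurable_fst.prodMk hx)
      exact this
    have hm' : Measurable fun p : CoordSeed n × (Fin n → ℝ) =>
        ((levelIndex k (-R) R p.1 i (p.2 i) : ℕ) : ℝ) :=
      (measurable_of_countable fun m : ℕ => (m : ℝ)).comp hm
    unfold levelValue
    exact (((hc.add (hm'.mul_const _)).const_mul _).const_add _).sub hx
  exact (Finset.measurable_fun_sum _ fun i _ => hi i).const_mul _

lemma measurable_coordError_left (k : ℕ) (R : ℝ) {n : ℕ} (x : Fin n → ℝ) :
    Measurable fun s : CoordSeed n => coordError k R s x := by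
  exact (measurable_coordError k R n).of_uncurry_right

lemma coordError_eq {k : ℕ} (hk : 2 ≤ k) {R : ℝ} (hR : 0 < R) {n : ℕ} {x : Fin n → ℝ}
    (hx : ∀ i, |x i| ≤ R) {s : CoordSeed n} (hs : IsGoodSeed k s) :
    coordError k R s x = 2 * R * spacing k / n *
      ∑ i, ceilError (((x i - -R) / (R - -R) - s.1) / spacing k) (dither s.2 i) := by
  unfold coordError
  simp only [levelValue_levelIndex hk hR (hx _) hs, add_sub_cancel_left, ← Finset.mul_sum]
  ring

lemma abs_coordError_le {k : ℕ} (hk : 2 ≤ k) {R : ℝ} (hR : 0 < R) {n : ℕ} {x : Fin n → ℝ}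
    (hx : ∀ i, |x i| ≤ R) {s : CoordSeed n} (hs : IsGoodSeed k s) :
    |coordError k R s x| ≤ 2 * R * spacing k := by
  have hβ := spacing_pos hk
  rcases Nat.eq_zero_or_pos n with rfl | hn
  · simp [coordError]
    positivity
  have hn' : (0 : ℝ) < n := by exact_mod_cast hn
  rw [coordError_eq hk hR hx hs, abs_mul, abs_of_nonneg (by positivity)]
  have : |∑ i, ceilError (((x i - -R) / (R - -R) - s.1) / spacing k) (dither s.2 i)| ≤ n := by
    refine (Finset.abs_sum_le_sum_abs _ _).trans ?_
    calc _ ≤ ∑ _i : Fin n, (1 : ℝ) :=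
          Finset.sum_le_sum fun i _ => abs_ceilError_le (dither_mem hs.2 i)
      _ = n := by simp
  calc _ ≤ 2 * R * spacing k / n * n := by gcongr
    _ = _ := by field_simp

lemma ae_abs_coordError_le {k : ℕ} (hk : 2 ≤ k) {R : ℝ} (hR : 0 < R) {n : ℕ} (hn : 0 < n)
    {x : Fin n → ℝ} (hx : ∀ i, |x i| ≤ R) :
    ∀ᵐ s ∂coordLaw n k, |coordError k R s x| ≤ 2 * R * spacing k := by
  filter_upwards [ae_isGoodSeed hn] with s hs using abs_coordError_le hk hR hx hs

lemma integral_coordLaw {n k : ℕ} (hn : 0 < n) {f : CoordSeed n → ℝ}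
    (hf : Integrable f (coordLaw n k)) :
    ∫ s, f s ∂coordLaw n k =
      ∫ c, ∫ t, f (c, t) ∂ditherLaw n ∂firstLevelLaw k := by
  have := isProbabilityMeasure_ditherLaw hn
  exact integral_prod f hf

lemma integrable_coordError {k : ℕ} (hk : 2 ≤ k) {R : ℝ} (hR : 0 < R) {n : ℕ} (hn : 0 < n)
    {x : Fin n → ℝ} (hx : ∀ i, |x i| ≤ R) :
    Integrable (fun s => coordError k R s x) (coordLaw n k) := by
  have := isProbabilityMeasure_coordLaw (k := k) hn (by omega)
  exact Integrable.of_bound (measurable_coordError_left k R x).aestronglyMeasurable _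
    (ae_abs_coordError_le hk hR hn hx)

/-- The estimate of one coordinate is unbiased. -/
lemma integral_coordError {k : ℕ} (hk : 2 ≤ k) {R : ℝ} (hR : 0 < R) {n : ℕ} (hn : 0 < n)
    {x : Fin n → ℝ} (hx : ∀ i, |x i| ≤ R) :
    ∫ s, coordError k R s x ∂coordLaw n k = 0 := by
  have := isProbabilityMeasure_ditherLaw hn
  rw [integral_coordLaw hn (integrable_coordError hk hR hn hx)]
  refine integral_eq_zero_of_ae ?_
  filter_upwards [ae_firstLevelLaw_mem k] with c hc
  have h : (fun t => coordError k R (c, t) x) =ᵐ[ditherLaw n] fun t => 2 * R * spacing k / n *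
      ∑ i, ceilError (((x i - -R) / (R - -R) - c) / spacing k) (dither t i) := by
    filter_upwards [ae_ditherLaw_mem hn] with t ht
    exact coordError_eq (s := (c, t)) hk hR hx ⟨hc, ht⟩
  rw [integral_congr_ae h, integral_const_mul,
    integral_finsetSum _ fun i _ => integrable_ceilError hn _ i]
  simp [integral_ceilError hn]

/-- The bound holds for each fixed first level `c`, which cancels in the differences `w i - v`;
integrating over `c` then costs nothing. The reference `r` is free and will be a coordinate of the
gradient. -/
lemma integral_coordError_sq_le {k : ℕ} (hk : 2 ≤ k) {R : ℝ} (hR : 0 < R) {n : ℕ} (hn : 0 < n)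
    {x : Fin n → ℝ} (hx : ∀ i, |x i| ≤ R) (r : ℝ) :
    ∫ s, coordError k R s x ^ 2 ∂coordLaw n k ≤
      (8 * (R * spacing k) ^ 2 + 12 * (R * spacing k) * ∑ i, |x i - r|) / n ^ 2 := by
  have := isProbabilityMeasure_ditherLaw hn
  have hprob := isProbabilityMeasure_coordLaw (k := k) hn (by omega)
  have hn' : (0 : ℝ) < n := by exact_mod_cast hn
  have hβ := spacing_pos hk
  have hint : Integrable (fun s => coordError k R s x ^ 2) (coordLaw n k) :=
    integrable_sq_of_abs_le (measurable_coordError_left k R x).aestronglyMeasurable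
      (ae_abs_coordError_le hk hR hn hx)
  set B := (8 * (R * spacing k) ^ 2 + 12 * (R * spacing k) * ∑ i, |x i - r|) / n ^ 2 with hB
  have := isProbabilityMeasure_firstLevelLaw (k := k) (by omega)
  rw [integral_coordLaw hn hint]
  calc _ ≤ ∫ _c, B ∂firstLevelLaw k := by
        refine integral_mono_ae (hint.integral_prod_left) (integrable_const _) ?_
        filter_upwards [ae_firstLevelLaw_mem k] with c hc
        have h : (fun t => coordError k R (c, t) x ^ 2) =ᵐ[ditherLaw n] fun t =>
            (2 * R * spacing k / n) ^ 2 *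
            (∑ i, ceilError (((x i - -R) / (R - -R) - c) / spacing k) (dither t i)) ^ 2 := by
          filter_upwards [ae_ditherLaw_mem hn] with t ht
          rw [coordError_eq (s := (c, t)) hk hR hx ⟨hc, ht⟩, mul_pow]
        rw [integral_congr_ae h, integral_const_mul]
        have h2 := integral_sum_ceilError_sq_le hn
          (fun i => ((x i - -R) / (R - -R) - c) / spacing k)
          (((r - -R) / (R - -R) - c) / spacing k)
        have h3 : ∀ i, |((x i - -R) / (R - -R) - c) / spacing k -
            ((r - -R) / (R - -R) - c) / spacing k| = |x i - r| / (2 * R * spacing k) := fun i => by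
          rw [show 2 * R * spacing k = |2 * R * spacing k| from (abs_of_pos (by positivity)).symm,
            ← abs_div]
          congr 1
          simp only [sub_neg_eq_add, ← two_mul]
          field_simp
          ring
        simp only [h3, ← Finset.sum_div] at h2
        calc _ ≤ (2 * R * spacing k / n) ^ 2 *
              (2 + 6 * ((∑ i, |x i - r|) / (2 * R * spacing k))) := by gcongr
          _ = B := by
              rw [hB]
              field_simp
              ring
    _ = B := by simp

/-! ## The quantized stochastic gradient -/

/-- Lossless decoding removes the bit strings: from here on only the exact average and a
coordinatewise error matter. -/
lemma serverEstimate_message_apply (k : ℕ) (R : ℝ) {n d : ℕ} (s : Fin d → CoordSeed n)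
    (x : Fin n → EuclideanSpace ℝ (Fin d)) (j : Fin d) :
    serverEstimate k R s (fun i => message k R s i (x i)) j =
      1 / (n : ℝ) * ∑ i, x i j + coordError k R (s j) fun i => x i j := by
  simp only [serverEstimate, message, decode_encode, coordError, PiLp.smul_apply, smul_eq_mul,
    WithLp.ofLp_sum, Finset.sum_apply, Finset.sum_sub_distrib]
  ring

/-- Law of the shared randomness of one round. -/
def sharedLaw (n d : ℕ) : Measure (Fin d → CoordSeed n) :=
  Measure.pi fun _ : Fin d => coordLaw n (numLevels d)

lemma isProbabilityMeasure_sharedLaw {n : ℕ} (hn : 0 < n) (d : ℕ) :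
    IsProbabilityMeasure (sharedLaw n d) := by
  have := isProbabilityMeasure_coordLaw (k := numLevels d) hn
    (by have := two_le_numLevels d; omega)
  unfold sharedLaw
  infer_instance

lemma ae_sharedLaw_isGoodSeed {n : ℕ} (hn : 0 < n) (d : ℕ) :
    ∀ᵐ s ∂sharedLaw n d, ∀ j, IsGoodSeed (numLevels d) (s j) := by
  have := isProbabilityMeasure_coordLaw (k := numLevels d) hn
    (by have := two_le_numLevels d; omega)
  rw [ae_all_iff]
  exact fun j => (measurePreserving_eval (fun _ : Fin d => coordLaw n (numLevels d))
    j).quasiMeasurePreserving.ae (ae_isGoodSeed hn)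

lemma integral_sharedLaw_apply {n : ℕ} (hn : 0 < n) {d : ℕ} (j : Fin d) {f : CoordSeed n → ℝ}
    (hf : Measurable f) :
    ∫ s, f (s j) ∂sharedLaw n d = ∫ s, f s ∂coordLaw n (numLevels d) := by
  have := isProbabilityMeasure_coordLaw (k := numLevels d) hn
    (by have := two_le_numLevels d; omega)
  exact integral_comp_eval (μ := fun _ : Fin d => coordLaw n (numLevels d))
    hf.aestronglyMeasurable

lemma abs_apply_le_of_norm_le {d : ℕ} {R : ℝ} {x : EuclideanSpace ℝ (Fin d)} (hx : ‖x‖ ≤ R)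
    (j : Fin d) : |x j| ≤ R :=
  (PiLp.norm_apply_le x j).trans hx

lemma sum_abs_apply_le {d : ℕ} (x : EuclideanSpace ℝ (Fin d)) :
    ∑ j, |x j| ≤ Real.sqrt d * ‖x‖ := by
  refine abs_le_of_sq_le_sq' ?_ (by positivity) |>.2
  rw [mul_pow, Real.sq_sqrt (Nat.cast_nonneg d), EuclideanSpace.norm_sq_eq]
  have := sq_sum_le_card_mul_sum_sq (s := Finset.univ) (f := fun j => |x j|)
  simpa using this

lemma spacing_numLevels_mul_sqrt_le (d : ℕ) : spacing (numLevels d) * Real.sqrt d ≤ 3 :=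
  (mul_le_mul_of_nonneg_left (sqrt_le_numLevels d) (spacing_pos (two_le_numLevels d)).le).trans
    (spacing_mul_le (two_le_numLevels d))

/-- Mean squared error of correlated quantization in `ℝᵈ`. -/
lemma sum_integral_coordError_sq_le {n d : ℕ} (hn : 0 < n) {R : ℝ} (hR : 0 < R)
    {x : Fin n → EuclideanSpace ℝ (Fin d)} (hx : ∀ i, ‖x i‖ ≤ R) (r : EuclideanSpace ℝ (Fin d)) :
    ∑ j, ∫ s, coordError (numLevels d) R (s j) (fun i => x i j) ^ 2 ∂sharedLaw n d ≤
      (72 * R ^ 2 + 36 * R * ∑ i, ‖x i - r‖) / n ^ 2 := by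
  set k := numLevels d with hk
  have hk2 : 2 ≤ k := two_le_numLevels d
  have hβ := spacing_pos hk2
  set β := spacing k with hβdef
  have hβd : β * Real.sqrt d ≤ 3 := spacing_numLevels_mul_sqrt_le d
  have hβd0 : 0 ≤ β * Real.sqrt d := by positivity
  have hβd2 : β ^ 2 * d ≤ 9 := by
    have : β ^ 2 * d = (β * Real.sqrt d) ^ 2 := by
      rw [mul_pow, Real.sq_sqrt (Nat.cast_nonneg d)]
    rw [this]
    nlinarith
  calc _ ≤ ∑ j, (8 * (R * β) ^ 2 + 12 * (R * β) * ∑ i, |x i j - r j|) / (n : ℝ) ^ 2 := by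
        refine Finset.sum_le_sum fun j _ => ?_
        rw [integral_sharedLaw_apply (f := fun s => coordError k R s (fun i => x i j) ^ 2) hn j
          ((measurable_coordError_left k R _).pow_const 2)]
        exact integral_coordError_sq_le hk2 hR hn (fun i => abs_apply_le_of_norm_le (hx i) j) _
    _ = (8 * R ^ 2 * (β ^ 2 * d) + 12 * R * β * ∑ i, ∑ j, |(x i - r) j|) / (n : ℝ) ^ 2 := by
        have : ∑ j, 12 * (R * β) * ∑ i, |x i j - r j| =
            12 * R * β * ∑ i, ∑ j, |(x i - r) j| := by
          rw [← Finset.mul_sum, Finset.sum_comm, ← mul_assoc]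
          rfl
        rw [← Finset.sum_div, Finset.sum_add_distrib, this]
        simp only [Finset.sum_const, Finset.card_univ, Fintype.card_fin, nsmul_eq_mul]
        ring
    _ ≤ (8 * R ^ 2 * (β ^ 2 * d) + 12 * R * β * ∑ i, (Real.sqrt d * ‖x i - r‖)) / (n : ℝ) ^ 2 := by
        gcongr
        exact sum_abs_apply_le _
    _ = (8 * R ^ 2 * (β ^ 2 * d) + 12 * R * ((β * Real.sqrt d) * ∑ i, ‖x i - r‖)) / (n : ℝ) ^ 2 := by
        rw [← Finset.mul_sum]
        ring
    -- The choice `k ≥ √d` enters here through `β √d ≤ β k ≤ 3`, which makes the bound free of the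
    -- dimension.
    _ ≤ (8 * R ^ 2 * 9 + 12 * R * (3 * ∑ i, ‖x i - r‖)) / (n : ℝ) ^ 2 := by
        gcongr
    _ = _ := by ring

/-! ### Moments of the oracle noise -/

namespace IsGradientOracle

variable {d : ℕ} {Ξ : Type*} [MeasurableSpace Ξ] {F : EuclideanSpace ℝ (Fin d) → ℝ} {D R σ : ℝ}
  {P : Measure Ξ} {g : EuclideanSpace ℝ (Fin d) → Ξ → EuclideanSpace ℝ (Fin d)}

lemma measurable_apply (hg : IsGradientOracle F D R σ P g) (w : EuclideanSpace ℝ (Fin d)) :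
    Measurable (g w) := hg.measurable.of_uncurry_left

lemma measurable_norm_sub_gradient (hg : IsGradientOracle F D R σ P g)
    (w : EuclideanSpace ℝ (Fin d)) : Measurable fun ξ => ‖g w ξ - gradient F w‖ :=
  ((hg.measurable_apply w).sub_const _).norm

variable [IsProbabilityMeasure P] {w : EuclideanSpace ℝ (Fin d)}

lemma norm_gradient_le (hg : IsGradientOracle F D R σ P g) (hw : ‖w‖ ≤ D) :
    ‖gradient F w‖ ≤ R := by
  rw [← hg.unbiased w hw]
  simpa using norm_integral_le_of_norm_le_const (hg.bounded w hw)

lemma ae_norm_sub_gradient_le (hg : IsGradientOracle F D R σ P g) (hw : ‖w‖ ≤ D) :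
    ∀ᵐ ξ ∂P, ‖g w ξ - gradient F w‖ ≤ 2 * R := by
  filter_upwards [hg.bounded w hw] with ξ hξ
  exact (norm_sub_le _ _).trans (by linarith [hg.norm_gradient_le hw])

lemma integrable_norm_sub_gradient (hg : IsGradientOracle F D R σ P g) (hw : ‖w‖ ≤ D) :
    Integrable (fun ξ => ‖g w ξ - gradient F w‖) P := by
  refine Integrable.of_bound (hg.measurable_norm_sub_gradient w).aestronglyMeasurable (2 * R) ?_
  simpa using hg.ae_norm_sub_gradient_le hw

lemma integrable_norm_sub_gradient_sq (hg : IsGradientOracle F D R σ P g) (hw : ‖w‖ ≤ D) :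
    Integrable (fun ξ => ‖g w ξ - gradient F w‖ ^ 2) P := by
  refine integrable_sq_of_abs_le (hg.measurable_norm_sub_gradient w).aestronglyMeasurable
    (C := 2 * R) ?_
  simpa using hg.ae_norm_sub_gradient_le hw

/-- Nonnegativity of the variance of the norm bounds its squared mean by `σ²`. -/
lemma integral_norm_sub_gradient_le (hg : IsGradientOracle F D R σ P g) (hσ : 0 ≤ σ)
    (hw : ‖w‖ ≤ D) : ∫ ξ, ‖g w ξ - gradient F w‖ ∂P ≤ σ := by
  refine abs_le_of_sq_le_sq' ?_ hσ |>.2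
  refine le_trans ?_ (hg.variance w hw)
  have hL : MemLp (fun ξ => ‖g w ξ - gradient F w‖) 2 P :=
    (memLp_two_iff_integrable_sq (hg.measurable_norm_sub_gradient w).aestronglyMeasurable).2
      (hg.integrable_norm_sub_gradient_sq hw)
  have h := variance_eq_sub hL
  have h0 := variance_nonneg (fun ξ => ‖g w ξ - gradient F w‖) P
  simp only [Pi.pow_apply] at h
  linarith

/-- One factor of the square is bounded by `2R` almost surely. The result is linear in `σ`, as the
final rate demands; `σ²` alone would not do when `σ` is much larger than `R`. -/
lemma integral_norm_sub_gradient_sq_le (hg : IsGradientOracle F D R σ P g) (hR : 0 < R)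
    (hσ : 0 ≤ σ) (hw : ‖w‖ ≤ D) : ∫ ξ, ‖g w ξ - gradient F w‖ ^ 2 ∂P ≤ 2 * R * σ := by
  calc _ ≤ ∫ ξ, 2 * R * ‖g w ξ - gradient F w‖ ∂P := by
        refine integral_mono_ae (hg.integrable_norm_sub_gradient_sq hw)
          ((hg.integrable_norm_sub_gradient hw).const_mul _) ?_
        filter_upwards [hg.ae_norm_sub_gradient_le hw] with ξ hξ
        rw [sq]
        exact mul_le_mul_of_nonneg_right hξ (norm_nonneg _)
    _ = 2 * R * ∫ ξ, ‖g w ξ - gradient F w‖ ∂P := integral_const_mul _ _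
    _ ≤ _ := by
        have := hg.integral_norm_sub_gradient_le hσ hw
        gcongr

lemma integrable_apply (hg : IsGradientOracle F D R σ P g) (hw : ‖w‖ ≤ D) (j : Fin d) :
    Integrable (fun ξ => g w ξ j) P := by
  refine Integrable.of_bound (Measurable.aestronglyMeasurable ?_) R ?_
  · exact (PiLp.continuous_apply 2 _ j).measurable.comp (hg.measurable_apply w)
  · filter_upwards [hg.bounded w hw] with ξ hξ
    exact abs_apply_le_of_norm_le hξ j

lemma integral_apply (hg : IsGradientOracle F D R σ P g) (hw : ‖w‖ ≤ D) (j : Fin d) :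
    ∫ ξ, g w ξ j ∂P = gradient F w j := by
  rw [← hg.unbiased w hw, eval_integral_piLp fun j => hg.integrable_apply hw j]

end IsGradientOracle

/-- Law of the randomness of one round. -/
def roundLaw (n d : ℕ) {Ξ : Type*} [MeasurableSpace Ξ] (P : Measure Ξ) :
    Measure (RoundSeed n d Ξ) :=
  (Measure.pi fun _ : Fin n => P).prod (sharedLaw n d)

/-- The quantized stochastic gradient at `w`. -/
def quantizedGradient (R : ℝ) {n d : ℕ} {Ξ : Type*}
    (g : EuclideanSpace ℝ (Fin d) → Ξ → EuclideanSpace ℝ (Fin d))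
    (w : EuclideanSpace ℝ (Fin d)) (s : RoundSeed n d Ξ) : EuclideanSpace ℝ (Fin d) :=
  serverEstimate (numLevels d) R s.2 (clientMessage R g w s)

/-- The quantization error of one coordinate of the gradient. -/
def gradientCoordError (R : ℝ) {n d : ℕ} {Ξ : Type*}
    (g : EuclideanSpace ℝ (Fin d) → Ξ → EuclideanSpace ℝ (Fin d))
    (w : EuclideanSpace ℝ (Fin d)) (j : Fin d) (s : RoundSeed n d Ξ) : ℝ :=
  coordError (numLevels d) R (s.2 j) fun i => g w (s.1 i) j

lemma quantizedGradient_apply (R : ℝ) {n d : ℕ} {Ξ : Type*}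
    (g : EuclideanSpace ℝ (Fin d) → Ξ → EuclideanSpace ℝ (Fin d))
    (w : EuclideanSpace ℝ (Fin d)) (s : RoundSeed n d Ξ) (j : Fin d) :
    quantizedGradient R g w s j =
      1 / (n : ℝ) * ∑ i, g w (s.1 i) j + gradientCoordError R g w j s :=
  serverEstimate_message_apply _ _ _ (fun i => g w (s.1 i)) j

lemma quantizedGradient_sub_apply (R : ℝ) {n d : ℕ} (hn : 0 < n) {Ξ : Type*}
    (g : EuclideanSpace ℝ (Fin d) → Ξ → EuclideanSpace ℝ (Fin d))
    (w v : EuclideanSpace ℝ (Fin d)) (s : RoundSeed n d Ξ) (j : Fin d) :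
    (quantizedGradient R g w s - v) j =
      1 / (n : ℝ) * ∑ i, (g w (s.1 i) - v) j + gradientCoordError R g w j s := by
  have hn' : (n : ℝ) ≠ 0 := by exact_mod_cast hn.ne'
  rw [PiLp.sub_apply, quantizedGradient_apply]
  simp only [PiLp.sub_apply, Finset.sum_sub_distrib, Finset.sum_const, Finset.card_univ,
    Fintype.card_fin, nsmul_eq_mul]
  field_simp
  ring

section

variable {d n : ℕ} {Ξ : Type*} [MeasurableSpace Ξ]

lemma isProbabilityMeasure_roundLaw (hn : 0 < n) (d : ℕ) (P : Measure Ξ)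
    [IsProbabilityMeasure P] : IsProbabilityMeasure (roundLaw n d P) := by
  have := isProbabilityMeasure_sharedLaw hn d
  unfold roundLaw
  infer_instance

variable {g : EuclideanSpace ℝ (Fin d) → Ξ → EuclideanSpace ℝ (Fin d)}

lemma measurable_gradientCoordError (hg : Measurable (Function.uncurry g)) (R : ℝ) (j : Fin d) :
    Measurable fun p : EuclideanSpace ℝ (Fin d) × RoundSeed n d Ξ =>
      gradientCoordError R g p.1 j p.2 := by
  have h1 : Measurable fun p : EuclideanSpace ℝ (Fin d) × RoundSeed n d Ξ => p.2.2 j :=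
    measurable_snd.snd.eval
  have h2 : Measurable fun p : EuclideanSpace ℝ (Fin d) × RoundSeed n d Ξ =>
      fun i => g p.1 (p.2.1 i) j := by
    refine measurable_pi_lambda _ fun i => ?_
    have h3 : Measurable fun p : EuclideanSpace ℝ (Fin d) × RoundSeed n d Ξ => (p.1, p.2.1 i) :=
      measurable_fst.prodMk measurable_snd.fst.eval
    exact (PiLp.continuous_apply 2 _ j).measurable.comp (hg.comp h3)
  have := (measurable_coordError (numLevels d) R n).comp (h1.prodMk h2)
  exact this

lemma measurable_gradientCoordError_right (hg : Measurable (Function.uncurry g)) (R : ℝ)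
    (w : EuclideanSpace ℝ (Fin d)) (j : Fin d) :
    Measurable fun s : RoundSeed n d Ξ => gradientCoordError R g w j s := by
  have := (measurable_gradientCoordError (n := n) hg R j).comp (measurable_prodMk_left (x := w))
  exact this

lemma measurable_quantizedGradient (hg : Measurable (Function.uncurry g)) (R : ℝ) :
    Measurable fun p : EuclideanSpace ℝ (Fin d) × RoundSeed n d Ξ =>
      quantizedGradient R g p.1 p.2 := by
  have h : Measurable fun p : EuclideanSpace ℝ (Fin d) × RoundSeed n d Ξ =>
      fun j => quantizedGradient R g p.1 p.2 j := by
    refine measurable_pi_lambda _ fun j => ?_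
    simp only [quantizedGradient_apply]
    refine ((Finset.measurable_fun_sum _ fun i _ => ?_).const_mul _).add
      (measurable_gradientCoordError hg R j)
    have h3 : Measurable fun p : EuclideanSpace ℝ (Fin d) × RoundSeed n d Ξ => (p.1, p.2.1 i) :=
      measurable_fst.prodMk measurable_snd.fst.eval
    exact (PiLp.continuous_apply 2 _ j).measurable.comp (hg.comp h3)
  have := (WithLp.measurable_toLp 2 (Fin d → ℝ)).comp h
  exact this

end

/-! ### Mean and mean squared error of the quantized gradient -/

namespace IsGradientOracle

variable {d n : ℕ} {Ξ : Type*} [MeasurableSpace Ξ] {F : EuclideanSpace ℝ (Fin d) → ℝ} {D R σ : ℝ}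
  {P : Measure Ξ} [IsProbabilityMeasure P]
  {g : EuclideanSpace ℝ (Fin d) → Ξ → EuclideanSpace ℝ (Fin d)} {w : EuclideanSpace ℝ (Fin d)}

lemma ae_pi_norm_le (hg : IsGradientOracle F D R σ P g) (hw : ‖w‖ ≤ D) :
    ∀ᵐ ξ ∂Measure.pi fun _ : Fin n => P, ∀ i, ‖g w (ξ i)‖ ≤ R := by
  rw [ae_all_iff]
  exact fun i => (measurePreserving_eval (fun _ : Fin n => P) i).quasiMeasurePreserving.ae
    (hg.bounded w hw)

lemma ae_roundLaw (hg : IsGradientOracle F D R σ P g) (hn : 0 < n) (hw : ‖w‖ ≤ D) :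
    ∀ᵐ s ∂roundLaw n d P, (∀ i, ‖g w (s.1 i)‖ ≤ R) ∧ ∀ j, IsGoodSeed (numLevels d) (s.2 j) := by
  have := isProbabilityMeasure_sharedLaw hn d
  filter_upwards [Measure.quasiMeasurePreserving_fst.ae (hg.ae_pi_norm_le hw),
    Measure.quasiMeasurePreserving_snd.ae (ae_sharedLaw_isGoodSeed hn d)] with s h1 h2
    using ⟨h1, h2⟩

lemma ae_abs_gradientCoordError_le (hg : IsGradientOracle F D R σ P g) (hn : 0 < n) (hR : 0 < R)
    (hw : ‖w‖ ≤ D) : ∀ᵐ s ∂roundLaw n d P, ∀ j,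
      |gradientCoordError R g w j s| ≤ 2 * R * spacing (numLevels d) := by
  filter_upwards [hg.ae_roundLaw hn hw] with s hs j
  exact abs_coordError_le (two_le_numLevels d) hR
    (fun i => abs_apply_le_of_norm_le (hs.1 i) j) (hs.2 j)

lemma integrable_gradientCoordError (hg : IsGradientOracle F D R σ P g) (hn : 0 < n) (hR : 0 < R)
    (hw : ‖w‖ ≤ D) (j : Fin d) :
    Integrable (gradientCoordError R g w j) (roundLaw n d P) := by
  have := isProbabilityMeasure_roundLaw hn d P
  refine Integrable.of_bound
    (measurable_gradientCoordError_right hg.measurable R w j).aestronglyMeasurable _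
    ((hg.ae_abs_gradientCoordError_le hn hR hw).mono fun s hs => hs j)

lemma integrable_gradientCoordError_sq (hg : IsGradientOracle F D R σ P g) (hn : 0 < n)
    (hR : 0 < R) (hw : ‖w‖ ≤ D) (j : Fin d) :
    Integrable (fun s => gradientCoordError R g w j s ^ 2) (roundLaw n d P) := by
  have := isProbabilityMeasure_roundLaw hn d P
  exact integrable_sq_of_abs_le
    (measurable_gradientCoordError_right hg.measurable R w j).aestronglyMeasurable
    ((hg.ae_abs_gradientCoordError_le hn hR hw).mono fun s hs => hs j)

/-- For fixed oracle answers of norm at most `R`, the quantizer is already unbiased over the shared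
randomness; Fubini does the rest. -/
lemma integral_gradientCoordError (hg : IsGradientOracle F D R σ P g) (hn : 0 < n) (hR : 0 < R)
    (hw : ‖w‖ ≤ D) (j : Fin d) : ∫ s, gradientCoordError R g w j s ∂roundLaw n d P = 0 := by
  have := isProbabilityMeasure_sharedLaw hn d
  have hint := hg.integrable_gradientCoordError hn hR hw j
  unfold roundLaw at hint ⊢
  rw [integral_prod _ hint]
  refine integral_eq_zero_of_ae ?_
  filter_upwards [hg.ae_pi_norm_le hw] with ξ hξ
  have := integral_sharedLaw_apply hn j
    (measurable_coordError_left (numLevels d) R (fun i => g w (ξ i) j))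
  exact this.trans (integral_coordError (two_le_numLevels d) hR hn
    fun i => abs_apply_le_of_norm_le (hξ i) j)

/-- The deterministic bound is used with reference `∇F(w)`, so the spread of the clients' inputs is
the oracle noise, whose mean norm is at most `σ`. -/
lemma sum_integral_gradientCoordError_sq_le (hg : IsGradientOracle F D R σ P g) (hn : 0 < n)
    (hR : 0 < R) (hσ : 0 ≤ σ) (hw : ‖w‖ ≤ D) :
    ∑ j, ∫ s, gradientCoordError R g w j s ^ 2 ∂roundLaw n d P ≤
      72 * (R ^ 2 / n ^ 2) + 36 * (σ * R / n) := by
  have := isProbabilityMeasure_sharedLaw hn d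
  have hn' : (0 : ℝ) < n := by exact_mod_cast hn
  have hint := fun j => hg.integrable_gradientCoordError_sq (n := n) hn hR hw j
  have hi : ∀ i, Integrable (fun ξ : Fin n → Ξ => ‖g w (ξ i) - gradient F w‖)
      (Measure.pi fun _ : Fin n => P) := fun i =>
    (measurePreserving_eval (fun _ : Fin n => P) i).integrable_comp_of_integrable
      (hg.integrable_norm_sub_gradient hw)
  have hval : ∀ i, ∫ ξ : Fin n → Ξ, ‖g w (ξ i) - gradient F w‖ ∂(Measure.pi fun _ : Fin n => P) ≤
      σ := fun i =>
    (integral_comp_eval (μ := fun _ : Fin n => P) (f := fun ξ => ‖g w ξ - gradient F w‖)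
      (hg.measurable_norm_sub_gradient w).aestronglyMeasurable).trans_le
      (hg.integral_norm_sub_gradient_le hσ hw)
  unfold roundLaw at hint ⊢
  rw [Finset.sum_congr rfl fun j _ => integral_prod _ (hint j),
    ← integral_finsetSum _ fun j _ => (hint j).integral_prod_left]
  calc _ ≤ ∫ ξ : Fin n → Ξ, (72 * R ^ 2 + 36 * R * ∑ i, ‖g w (ξ i) - gradient F w‖) / (n : ℝ) ^ 2
          ∂(Measure.pi fun _ : Fin n => P) := by
        refine integral_mono_ae (integrable_finsetSum _ fun j _ => (hint j).integral_prod_left)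
          (((integrable_const _).add ((integrable_finsetSum _ fun i _ => hi i).const_mul _)).div_const
            _) ?_
        filter_upwards [hg.ae_pi_norm_le hw] with ξ hξ
        exact sum_integral_coordError_sq_le hn hR hξ _
    _ = (72 * R ^ 2 + 36 * R * ∑ i, ∫ ξ : Fin n → Ξ, ‖g w (ξ i) - gradient F w‖
          ∂(Measure.pi fun _ : Fin n => P)) / (n : ℝ) ^ 2 := by
        rw [integral_div, integral_add (integrable_const _)
          ((integrable_finsetSum _ fun i _ => hi i).const_mul _),
          integral_const_mul (36 * R) (fun ξ : Fin n → Ξ => ∑ i, ‖g w (ξ i) - gradient F w‖),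
          integral_finsetSum (μ := Measure.pi fun _ : Fin n => P) Finset.univ fun i _ => hi i]
        simp
    _ ≤ (72 * R ^ 2 + 36 * R * ∑ _i : Fin n, σ) / (n : ℝ) ^ 2 := by
        gcongr with i
        exact hval i
    _ = _ := by
        simp only [Finset.sum_const, Finset.card_univ, Fintype.card_fin, nsmul_eq_mul]
        field_simp

lemma memLp_sub_gradient_apply (hg : IsGradientOracle F D R σ P g) (hw : ‖w‖ ≤ D) (j : Fin d) :
    MemLp (fun ξ => (g w ξ - gradient F w) j) 2 P := by
  refine MemLp.of_bound (Measurable.aestronglyMeasurable ?_) (2 * R) ?_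
  · exact (PiLp.continuous_apply 2 _ j).measurable.comp ((hg.measurable_apply w).sub_const _)
  · filter_upwards [hg.ae_norm_sub_gradient_le hw] with ξ hξ
    exact abs_apply_le_of_norm_le hξ j

lemma integral_sub_gradient_apply (hg : IsGradientOracle F D R σ P g) (hw : ‖w‖ ≤ D) (j : Fin d) :
    ∫ ξ, (g w ξ - gradient F w) j ∂P = 0 := by
  simp only [PiLp.sub_apply]
  rw [integral_sub (hg.integrable_apply hw j) (integrable_const _), hg.integral_apply hw j]
  simp

lemma memLp_sum_sub_gradient_apply (hg : IsGradientOracle F D R σ P g) (hn : 0 < n) (hw : ‖w‖ ≤ D)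
    (j : Fin d) :
    MemLp (fun s : RoundSeed n d Ξ => ∑ i, (g w (s.1 i) - gradient F w) j) 2
      (roundLaw n d P) := by
  have := isProbabilityMeasure_sharedLaw hn d
  refine memLp_finsetSum _ fun i _ => ?_
  exact ((hg.memLp_sub_gradient_apply hw j).comp_measurePreserving
    (measurePreserving_eval (fun _ : Fin n => P) i)).comp_measurePreserving measurePreserving_fst

lemma integral_sum_sub_gradient_apply (hg : IsGradientOracle F D R σ P g) (hn : 0 < n)
    (hw : ‖w‖ ≤ D) (j : Fin d) :
    ∫ s : RoundSeed n d Ξ, ∑ i, (g w (s.1 i) - gradient F w) j ∂roundLaw n d P = 0 := by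
  have := isProbabilityMeasure_sharedLaw hn d
  unfold roundLaw
  have hi : ∀ i, Integrable (fun ξ : Fin n → Ξ => (g w (ξ i) - gradient F w) j)
      (Measure.pi fun _ : Fin n => P) := fun i =>
    ((hg.memLp_sub_gradient_apply hw j).comp_measurePreserving
      (measurePreserving_eval (fun _ : Fin n => P) i)).integrable one_le_two
  rw [integral_fun_fst (fun ξ : Fin n → Ξ => ∑ i, (g w (ξ i) - gradient F w) j),
    integral_finsetSum _ fun i _ => hi i, Finset.sum_eq_zero, smul_zero]
  intro i _
  exact (integral_comp_eval (μ := fun _ : Fin n => P)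
    (hg.memLp_sub_gradient_apply hw j).aestronglyMeasurable).trans
    (hg.integral_sub_gradient_apply hw j)

lemma integral_sum_sub_gradient_apply_sq_le (hg : IsGradientOracle F D R σ P g) (hn : 0 < n)
    (hw : ‖w‖ ≤ D) (j : Fin d) :
    ∫ s : RoundSeed n d Ξ, (∑ i, (g w (s.1 i) - gradient F w) j) ^ 2 ∂roundLaw n d P ≤
      n * ∫ ξ, (g w ξ - gradient F w) j ^ 2 ∂P := by
  have := isProbabilityMeasure_sharedLaw hn d
  unfold roundLaw
  rw [integral_fun_fst (fun ξ : Fin n → Ξ => (∑ i, (g w (ξ i) - gradient F w) j) ^ 2)]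
  have := integral_sum_sq_pi_le (X := fun (_ : Fin n) ξ => (g w ξ - gradient F w) j)
    fun _ => hg.memLp_sub_gradient_apply hw j
  simp only [hg.integral_sub_gradient_apply hw j] at this
  simpa only [Finset.sum_const, Finset.card_univ, Fintype.card_fin, nsmul_eq_mul, mul_zero, ne_eq,
    OfNat.ofNat_ne_zero, not_false_eq_true, zero_pow, add_zero, probReal_univ, one_smul] using this

/-- The quantized stochastic gradient is square integrable. -/
lemma integrable_norm_quantizedGradient_sub_sq (hg : IsGradientOracle F D R σ P g) (hn : 0 < n)
    (hR : 0 < R) (hw : ‖w‖ ≤ D) :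
    Integrable (fun s => ‖quantizedGradient R g w s - gradient F w‖ ^ 2) (roundLaw n d P) := by
  have hprob := isProbabilityMeasure_roundLaw hn d P
  simp only [EuclideanSpace.norm_sq_eq, quantizedGradient_sub_apply R hn, Real.norm_eq_abs, sq_abs]
  refine integrable_finsetSum _ fun j _ => ?_
  exact (((hg.memLp_sum_sub_gradient_apply hn hw j).const_mul _).add
    ((memLp_two_iff_integrable_sq (hg.integrable_gradientCoordError hn hR hw j).1).2
      (hg.integrable_gradientCoordError_sq hn hR hw j))).integrable_sq

/-- The quantized stochastic gradient is unbiased. -/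
lemma integral_quantizedGradient_sub_inner (hg : IsGradientOracle F D R σ P g) (hn : 0 < n)
    (hR : 0 < R) (hw : ‖w‖ ≤ D) (a : EuclideanSpace ℝ (Fin d)) :
    Integrable (fun s => inner ℝ (quantizedGradient R g w s - gradient F w) a) (roundLaw n d P) ∧
    ∫ s, inner ℝ (quantizedGradient R g w s - gradient F w) a ∂roundLaw n d P = 0 := by
  have hprob := isProbabilityMeasure_roundLaw hn d P
  have hi : ∀ j, Integrable (fun s => a j * (quantizedGradient R g w s - gradient F w) j)
      (roundLaw n d P) := fun j => by
    simp only [quantizedGradient_sub_apply R hn]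
    exact ((((hg.memLp_sum_sub_gradient_apply hn hw j).integrable one_le_two).const_mul _).add
      (hg.integrable_gradientCoordError hn hR hw j)).const_mul _
  simp only [PiLp.inner_apply, RCLike.inner_apply, conj_trivial]
  refine ⟨integrable_finsetSum _ fun j _ => hi j, ?_⟩
  rw [integral_finsetSum _ fun j _ => hi j]
  refine Finset.sum_eq_zero fun j _ => ?_
  simp only [quantizedGradient_sub_apply R hn]
  rw [integral_const_mul, integral_add
    (((hg.memLp_sum_sub_gradient_apply hn hw j).integrable one_le_two).const_mul _)
    (hg.integrable_gradientCoordError hn hR hw j), integral_const_mul,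
    hg.integral_gradientCoordError hn hR hw j, hg.integral_sum_sub_gradient_apply hn hw j]
  simp

/-- Mean squared error of the quantized stochastic gradient. -/
lemma integral_norm_quantizedGradient_sub_sq_le (hg : IsGradientOracle F D R σ P g) (hn : 0 < n)
    (hR : 0 < R) (hσ : 0 ≤ σ) (hw : ‖w‖ ≤ D) :
    ∫ s, ‖quantizedGradient R g w s - gradient F w‖ ^ 2 ∂roundLaw n d P ≤
      144 * (σ * R / n + R ^ 2 / n ^ 2) := by
  have hprob := isProbabilityMeasure_roundLaw hn d P
  have hn' : (0 : ℝ) < n := by exact_mod_cast hn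
  have hM := fun j => (hg.memLp_sum_sub_gradient_apply (n := n) hn hw j).integrable_sq
  have hE := fun j => hg.integrable_gradientCoordError_sq (n := n) hn hR hw j
  have hsq : ∑ j, ∫ ξ, (g w ξ - gradient F w) j ^ 2 ∂P ≤ 2 * R * σ := by
    rw [← integral_finsetSum _ fun j _ => (hg.memLp_sub_gradient_apply hw j).integrable_sq]
    have := hg.integral_norm_sub_gradient_sq_le hR hσ hw
    simpa only [EuclideanSpace.norm_sq_eq, Real.norm_eq_abs, sq_abs] using this
  -- The inequality `(a + b)² ≤ 2a² + 2b²` separates sampling error from quantization error, so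
  -- their cross term need not be computed.
  calc _ ≤ ∫ s : RoundSeed n d Ξ, ∑ j, (2 / (n : ℝ) ^ 2 * (∑ i, (g w (s.1 i) - gradient F w) j) ^ 2 +
          2 * gradientCoordError R g w j s ^ 2) ∂roundLaw n d P := by
        refine integral_mono (hg.integrable_norm_quantizedGradient_sub_sq hn hR hw)
          (integrable_finsetSum _ fun j _ => ((hM j).const_mul _).add ((hE j).const_mul _)) fun s => ?_
        simp only [EuclideanSpace.norm_sq_eq, Real.norm_eq_abs, sq_abs]
        refine Finset.sum_le_sum fun j _ => ?_
        rw [quantizedGradient_sub_apply R hn]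
        set X := ∑ i, (g w (s.1 i) - gradient F w) j
        have : 2 / (n : ℝ) ^ 2 * X ^ 2 = 2 * (1 / (n : ℝ) * X) ^ 2 := by ring
        rw [this]
        nlinarith [sq_nonneg (1 / (n : ℝ) * X - gradientCoordError R g w j s)]
    _ = 2 / (n : ℝ) ^ 2 * ∑ j, ∫ s : RoundSeed n d Ξ, (∑ i, (g w (s.1 i) - gradient F w) j) ^ 2
          ∂roundLaw n d P + 2 * ∑ j, ∫ s, gradientCoordError R g w j s ^ 2 ∂roundLaw n d P := by
        have hj : ∀ j, Integrable (fun s : RoundSeed n d Ξ =>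
            2 / (n : ℝ) ^ 2 * (∑ i, (g w (s.1 i) - gradient F w) j) ^ 2 +
            2 * gradientCoordError R g w j s ^ 2) (roundLaw n d P) := fun j =>
          ((hM j).const_mul _).add ((hE j).const_mul _)
        rw [integral_finsetSum _ fun j _ => hj j, Finset.mul_sum, Finset.mul_sum, ← Finset.sum_add_distrib]
        refine Finset.sum_congr rfl fun j _ => ?_
        rw [integral_add ((hM j).const_mul _) ((hE j).const_mul _), integral_const_mul,
          integral_const_mul]
    _ ≤ 2 / (n : ℝ) ^ 2 * ∑ j, (n * ∫ ξ, (g w ξ - gradient F w) j ^ 2 ∂P) +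
          2 * (72 * (R ^ 2 / n ^ 2) + 36 * (σ * R / n)) := by
        gcongr with j
        · exact hg.integral_sum_sub_gradient_apply_sq_le hn hw j
        · exact hg.sum_integral_gradientCoordError_sq_le hn hR hσ hw
    _ ≤ 2 / (n : ℝ) ^ 2 * (n * (2 * R * σ)) + 2 * (72 * (R ^ 2 / n ^ 2) + 36 * (σ * R / n)) := by
        rw [← Finset.mul_sum]
        gcongr
    -- Sampling contributes `2 · 2 = 4` and quantization `2 · 36 = 72` to the first coefficient; the
    -- second is `2 · 72 = 144`, the larger of the two.
    _ = 76 * (σ * R / n) + 144 * (R ^ 2 / n ^ 2) := by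
        field_simp
        ring
    _ ≤ _ := by
        have : 0 ≤ σ * R / n := by positivity
        linarith

end IsGradientOracle

/-! ## Smooth convex functions and the projected gradient step -/

section

variable {E : Type*} [NormedAddCommGroup E] [InnerProductSpace ℝ E]

lemma hasDerivAt_comp_lineMap [CompleteSpace E] {F : E → ℝ} {x y : E} {t : ℝ}
    (hF : DifferentiableAt ℝ F (AffineMap.lineMap x y t)) :
    HasDerivAt (fun t : ℝ => F (AffineMap.lineMap x y t))
      (inner ℝ (gradient F (AffineMap.lineMap x y t)) (y - x)) t := by
  exact hF.hasGradientAt.hasFDerivAt.comp_hasDerivAt t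
    (AffineMap.hasDerivAt_lineMap (a := x) (b := y) (x := t))

/-- A convex function lies above its tangents. -/
lemma add_inner_gradient_le_of_convexOn [CompleteSpace E] {F : E → ℝ} {S : Set E}
    (hF : ConvexOn ℝ S F) {x y : E} (hx : x ∈ S) (hy : y ∈ S) (hd : DifferentiableAt ℝ F x) :
    F x + inner ℝ (gradient F x) (y - x) ≤ F y := by
  have hc := hF.comp_affineMap (AffineMap.lineMap x y : ℝ →ᵃ[ℝ] E)
  have hd' : HasDerivAt (F ∘ (AffineMap.lineMap x y : ℝ →ᵃ[ℝ] E))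
      (inner ℝ (gradient F x) (y - x)) 0 := by
    have := hasDerivAt_comp_lineMap (F := F) (x := x) (y := y) (t := 0) (by simpa using hd)
    simp only [AffineMap.lineMap_apply_zero] at this
    exact this
  have := hc.le_slope_of_hasDerivAt (x := 0) (y := 1) (by simpa using hx) (by simpa using hy)
    one_pos hd'
  simp only [slope_def_field, Function.comp_apply, AffineMap.lineMap_apply_one,
    AffineMap.lineMap_apply_zero, sub_zero, div_one] at this
  linarith

/-- Quadratic upper bound for functions with Lipschitz gradient on a convex set. -/
lemma le_add_inner_gradient_add_sq [CompleteSpace E] {F : E → ℝ} {S : Set E} (hS : Convex ℝ S)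
    (hd : ∀ w ∈ S, DifferentiableAt ℝ F w) {H : ℝ}
    (hH : ∀ w ∈ S, ∀ w' ∈ S, ‖gradient F w - gradient F w'‖ ≤ H * ‖w - w'‖)
    {x y : E} (hx : x ∈ S) (hy : y ∈ S) :
    F y ≤ F x + inner ℝ (gradient F x) (y - x) + H / 2 * ‖y - x‖ ^ 2 := by
  have hmem : ∀ t ∈ Set.Icc (0 : ℝ) 1, AffineMap.lineMap x y t ∈ S := fun t ht =>
    hS.lineMap_mem hx hy ht
  set a := inner ℝ (gradient F x) (y - x)
  -- The difference between `F` along the segment and its expected quadratic bound. The Lipschitz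
  -- condition makes its derivative nonpositive, and the claim compares the endpoints.
  set ψ : ℝ → ℝ := fun t => F (AffineMap.lineMap x y t) - (t * a + H / 2 * ‖y - x‖ ^ 2 * t ^ 2)
  have hψ : ∀ t ∈ Set.Icc (0 : ℝ) 1, HasDerivAt ψ
      (inner ℝ (gradient F (AffineMap.lineMap x y t)) (y - x) - (a + H * ‖y - x‖ ^ 2 * t)) t := by
    intro t ht
    refine (hasDerivAt_comp_lineMap (hd _ (hmem t ht))).sub ?_
    have h1 := (hasDerivAt_id t).mul_const a
    have h2 := ((hasDerivAt_id t).pow 2).const_mul (H / 2 * ‖y - x‖ ^ 2)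
    refine (h1.add h2).congr_deriv ?_
    simp
    ring
  have hanti : AntitoneOn ψ (Set.Icc 0 1) := by
    refine antitoneOn_of_deriv_nonpos (convex_Icc 0 1)
      (fun t ht => (hψ t ht).continuousAt.continuousWithinAt) ?_ ?_
    · intro t ht
      exact (hψ t (interior_subset ht)).differentiableAt.differentiableWithinAt
    · intro t ht
      have ht' := interior_subset ht
      rw [(hψ t ht').deriv, ← sub_sub, ← inner_sub_left, sub_nonpos]
      calc _ ≤ ‖gradient F (AffineMap.lineMap x y t) - gradient F x‖ * ‖y - x‖ :=
            real_inner_le_norm _ _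
        _ ≤ H * ‖AffineMap.lineMap x y t - x‖ * ‖y - x‖ := by
            gcongr
            exact hH _ (hmem t ht') _ hx
        _ = _ := by
            rw [AffineMap.lineMap_apply_module', add_sub_cancel_right, norm_smul,
              Real.norm_of_nonneg ht'.1]
            ring
  have := hanti (Set.left_mem_Icc.2 zero_le_one) (Set.right_mem_Icc.2 zero_le_one) zero_le_one
  simp only [ψ, AffineMap.lineMap_apply_one, AffineMap.lineMap_apply_zero] at this
  linarith

end

/-! ### Projection onto the ball and the one-step inequality -/

variable {d : ℕ}

lemma norm_projBall_le {D : ℝ} (hD : 0 ≤ D) (v : EuclideanSpace ℝ (Fin d)) :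
    ‖projBall D v‖ ≤ D := by
  unfold projBall
  split_ifs with h
  · exact h
  · have hv : 0 < ‖v‖ := by linarith [not_le.1 h]
    rw [norm_smul, norm_div, norm_norm, Real.norm_of_nonneg hD]
    field_simp
    exact le_rfl

/-- The variational inequality of the projection. Outside the ball `v - projBall D v` is a
nonnegative multiple of `v`, and Cauchy–Schwarz gives `⟪v, u⟫ ≤ ‖v‖ D`. -/
lemma inner_sub_projBall_le {D : ℝ} (hD : 0 ≤ D) (v : EuclideanSpace ℝ (Fin d))
    {u : EuclideanSpace ℝ (Fin d)} (hu : ‖u‖ ≤ D) :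
    inner ℝ (v - projBall D v) (u - projBall D v) ≤ 0 := by
  unfold projBall
  split_ifs with h
  · simp
  · have hDv := not_le.1 h
    have hv : 0 < ‖v‖ := by linarith
    have h1 : v - (D / ‖v‖) • v = (1 - D / ‖v‖) • v := by rw [sub_smul, one_smul]
    rw [h1, real_inner_smul_left, inner_sub_right, real_inner_smul_right,
      real_inner_self_eq_norm_sq]
    refine mul_nonpos_of_nonneg_of_nonpos ?_ ?_
    · rw [sub_nonneg, div_le_one hv]
      exact hDv.le
    · have h2 := real_inner_le_norm v u
      have h3 : D / ‖v‖ * ‖v‖ ^ 2 = ‖v‖ * D := by field_simp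
      rw [h3]
      nlinarith

lemma measurable_projBall (D : ℝ) : Measurable (projBall D : EuclideanSpace ℝ (Fin d) → _) := by
  unfold projBall
  exact Measurable.ite (measurableSet_le measurable_norm measurable_const) measurable_id
    ((measurable_const.div measurable_norm).smul measurable_id)

/-- Progress of one projected step with an inexact gradient `γ`. -/
lemma projBall_step_le {F : EuclideanSpace ℝ (Fin d) → ℝ} {D H η : ℝ} (hD : 0 ≤ D) (hH0 : 0 ≤ H)
    (hη : 0 < η) (hF : ConvexOn ℝ (Metric.closedBall 0 D) F)
    (hd : ∀ w ∈ Metric.closedBall 0 D, DifferentiableAt ℝ F w)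
    (hH : ∀ w ∈ Metric.closedBall 0 D, ∀ w' ∈ Metric.closedBall 0 D,
      ‖gradient F w - gradient F w'‖ ≤ H * ‖w - w'‖)
    {w u : EuclideanSpace ℝ (Fin d)} (hw : w ∈ Metric.closedBall 0 D)
    (hu : u ∈ Metric.closedBall 0 D) (γ : EuclideanSpace ℝ (Fin d)) :
    F (projBall D (w - (1 / (H + 1 / η)) • γ)) +
        (H + 1 / η) / 2 * ‖projBall D (w - (1 / (H + 1 / η)) • γ) - u‖ ^ 2 ≤
      F u + (H + 1 / η) / 2 * ‖w - u‖ ^ 2 + η / 2 * ‖γ - gradient F w‖ ^ 2 +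
        inner ℝ (γ - gradient F w) (u - w) := by
  set K := H + 1 / η with hK
  have hK0 : 0 < K := by positivity
  set p := projBall D (w - (1 / K) • γ) with hp
  have hpm : p ∈ Metric.closedBall 0 D := by
    rw [mem_closedBall_zero_iff]
    exact norm_projBall_le hD _
  have h1 := inner_sub_projBall_le hD (w - (1 / K) • γ) (mem_closedBall_zero_iff.1 hu)
  rw [← hp] at h1
  have h2 := add_inner_gradient_le_of_convexOn hF hw hu (hd w hw)
  have h3 := le_add_inner_gradient_add_sq (convex_closedBall 0 D) hd hH hw hpm
  set e := γ - gradient F w with he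
  have hγ : γ = gradient F w + e := by rw [he]; abel
  -- The projection inequality `h1`, multiplied by `K`.
  have h4 : K * inner ℝ (w - p) (u - p) ≤ inner ℝ γ (u - p) := by
    have : w - (1 / K) • γ - p = (w - p) - (1 / K) • γ := by abel
    rw [this, inner_sub_left, real_inner_smul_left, sub_nonpos] at h1
    calc _ ≤ K * (1 / K * inner ℝ γ (u - p)) := by gcongr
      _ = _ := by field_simp
  have h5 : ‖w - u‖ ^ 2 = ‖w - p‖ ^ 2 - 2 * inner ℝ (w - p) (u - p) + ‖p - u‖ ^ 2 := by
    have : w - u = (w - p) - (u - p) := by abel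
    rw [this, norm_sub_sq_real, norm_sub_rev u p]
  -- The new point `p` depends on the noise `e`, so this term has no zero mean; Young's inequality
  -- absorbs it. The remaining `⟪e, u - w⟫` involves only the old point and averages to zero.
  have h6 : -inner ℝ e (p - w) ≤ η / 2 * ‖e‖ ^ 2 + 1 / η / 2 * ‖w - p‖ ^ 2 := by
    have a1 := abs_real_inner_le_norm e (p - w)
    rw [norm_sub_rev p w] at a1
    have a2 := neg_le_abs (inner ℝ e (p - w))
    have a3 : ‖e‖ * ‖w - p‖ ≤ η / 2 * ‖e‖ ^ 2 + 1 / η / 2 * ‖w - p‖ ^ 2 := by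
      have : η / 2 * ‖e‖ ^ 2 + 1 / η / 2 * ‖w - p‖ ^ 2 - ‖e‖ * ‖w - p‖ =
          (η * ‖e‖ - ‖w - p‖) ^ 2 / (2 * η) := by
        field_simp
        ring
      have h0 : 0 ≤ (η * ‖e‖ - ‖w - p‖) ^ 2 / (2 * η) := by positivity
      linarith
    linarith
  rw [norm_sub_rev p w] at h3
  have e1 : inner ℝ (gradient F w) (p - w) = inner ℝ (gradient F w) (u - w) -
      inner ℝ (gradient F w) (u - p) := by
    rw [← inner_sub_right]
    congr 1
    abel
  have e2 : inner ℝ γ (u - p) = inner ℝ (gradient F w) (u - p) + inner ℝ e (u - p) := by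
    rw [hγ, inner_add_left]
  have e3 : inner ℝ e (u - p) = inner ℝ e (u - w) - inner ℝ e (p - w) := by
    rw [← inner_sub_right]
    congr 1
    abel
  -- In `K = H + 1/η` the part `H` cancels the smoothness term and `1/η` the term from Young's
  -- inequality.
  have e4 : K / 2 * ‖w - u‖ ^ 2 = H / 2 * ‖w - p‖ ^ 2 + 1 / η / 2 * ‖w - p‖ ^ 2 -
      K * inner ℝ (w - p) (u - p) + K / 2 * ‖p - u‖ ^ 2 := by
    rw [h5, hK]
    ring
  linarith

/-! ## Number of bits -/

/-- The index is `x/(2Rβ) + 1/(2β) - c/β + e`. The point `1/(2β)` differs from `k/2` by at most 1,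
and `-c/β`, the rounding error `e` and the floor in `k / 2` are bounded too. The constant 4 leaves
room. -/
lemma abs_levelIndex_sub_le {k : ℕ} (hk : 2 ≤ k) {R x : ℝ} (hR : 0 < R) (hx : |x| ≤ R) {n : ℕ}
    {s : CoordSeed n} (hs : IsGoodSeed k s) (i : Fin n) :
    |(levelIndex k (-R) R s i x : ℝ) - (k / 2 : ℕ)| ≤ 4 + k * |x| / (2 * R) := by
  have h := levelValue_levelIndex hk hR hx hs i
  have he := abs_ceilError_le (v := ((x - -R) / (R - -R) - s.1) / spacing k)
    (dither_mem hs.2 i)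
  set e := ceilError (((x - -R) / (R - -R) - s.1) / spacing k) (dither s.2 i)
  set m : ℝ := (levelIndex k (-R) R s i x : ℝ) with hm
  have hk2 : (2 : ℝ) ≤ k := by exact_mod_cast hk
  have hβ := spacing_pos hk
  have hβk := inv_spacing_le hk
  have hmid : (spacing k)⁻¹ / 2 - k / 2 = -(k / (k + 1)) := by
    unfold spacing
    rw [inv_div]
    field_simp
    ring
  have hfrac0 : 0 ≤ (k : ℝ) / (k + 1) := by positivity
  have hfrac1 : (k : ℝ) / (k + 1) ≤ 1 := by
    rw [div_le_one (by positivity)]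
    linarith
  have hc0 : 0 ≤ -s.1 * (spacing k)⁻¹ := mul_nonneg (by linarith [hs.1.2]) (by positivity)
  have hc1 : -s.1 * (spacing k)⁻¹ ≤ 1 := by
    calc -s.1 * (spacing k)⁻¹ ≤ 1 / k * k :=
          mul_le_mul (by linarith [hs.1.1]) hβk (by positivity) (by positivity)
      _ = 1 := by field_simp
  have hx1 : |x / (2 * R) * (spacing k)⁻¹| ≤ k * |x| / (2 * R) := by
    rw [abs_mul, abs_div, abs_of_pos (show 0 < 2 * R by positivity),
      abs_of_pos (inv_pos.2 hβ)]
    calc _ ≤ |x| / (2 * R) * k := by gcongr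
      _ = _ := by ring
  have hmeq : m - k / 2 = x / (2 * R) * (spacing k)⁻¹ + ((spacing k)⁻¹ / 2 - k / 2) +
      -s.1 * (spacing k)⁻¹ + e := by
    unfold levelValue at h
    rw [← hm] at h
    have : m = x / (2 * R) * (spacing k)⁻¹ + (spacing k)⁻¹ / 2 + -s.1 * (spacing k)⁻¹ + e := by
      field_simp
      linarith
    linarith
  have hfloor1 : ((k / 2 : ℕ) : ℝ) ≤ k / 2 := Nat.cast_div_le
  have hfloor2 : (k : ℝ) / 2 - 1 / 2 ≤ ((k / 2 : ℕ) : ℝ) := by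
    have : k ≤ 2 * (k / 2) + 1 := by omega
    have : (k : ℝ) ≤ 2 * ((k / 2 : ℕ) : ℝ) + 1 := by exact_mod_cast this
    linarith
  have hx2 := abs_le.1 hx1
  have he2 := abs_le.1 he
  rw [abs_le]
  constructor <;> linarith [hx2.1, hx2.2, he2.1, he2.2]

/-- Constant offsets cost `4 · 4 + 2 = 18` bits per coordinate. The rest is at most `2k√d ≤ 2(√d +
1)√d ≤ 4d`, where the upper bound on `k` is essential. -/
lemma length_message_le {n d : ℕ} (hd : 0 < d) {R : ℝ} (hR : 0 < R)
    {x : EuclideanSpace ℝ (Fin d)} (hx : ‖x‖ ≤ R) {s : Fin d → CoordSeed n}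
    (hs : ∀ j, IsGoodSeed (numLevels d) (s j)) (i : Fin n) :
    ((message (numLevels d) R s i x).length : ℝ) ≤ 22 * d := by
  have hd1 : (1 : ℝ) ≤ d := by exact_mod_cast hd
  have hsq : Real.sqrt d * Real.sqrt d = d := Real.mul_self_sqrt (Nat.cast_nonneg d)
  have hsq1 : Real.sqrt d ≤ d := by
    rw [Real.sqrt_le_left (by linarith)]
    nlinarith
  calc _ ≤ ∑ j, (4 * |(levelIndex (numLevels d) (-R) R (s j) i (x j) : ℝ) -
          (numLevels d / 2 : ℕ)| + 2) := length_encode_le _ _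
    _ ≤ ∑ j, (4 * (4 + numLevels d * |x j| / (2 * R)) + 2) := by
        gcongr with j
        exact abs_levelIndex_sub_le (two_le_numLevels d) hR (abs_apply_le_of_norm_le hx j)
          (hs j) i
    _ = 18 * d + 2 * numLevels d / R * ∑ j, |x j| := by
        have : ∀ j, 4 * (4 + numLevels d * |x j| / (2 * R)) + 2 =
            18 + 2 * numLevels d / R * |x j| := fun j => by
          field_simp
          ring
        simp only [this, Finset.sum_add_distrib, ← Finset.mul_sum, Finset.sum_const,
          Finset.card_univ, Fintype.card_fin, nsmul_eq_mul]
        ring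
    _ ≤ 18 * d + 2 * (Real.sqrt d + 1) / R * (Real.sqrt d * R) := by
        gcongr
        · exact numLevels_le hd
        · exact (sum_abs_apply_le x).trans (by gcongr)
    _ = 18 * d + 2 * (Real.sqrt d * Real.sqrt d + Real.sqrt d) := by
        field_simp
    _ ≤ 22 * d := by
        rw [hsq]
        linarith

/-! ## The law of a run -/

/-- Resampling one coordinate does not change a product measure. -/
lemma measurePreserving_update {ι : Type*} [Fintype ι] [DecidableEq ι] {X : Type*}
    [MeasurableSpace X] (ρ : Measure X) [IsProbabilityMeasure ρ] (t : ι) :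
    MeasurePreserving (fun p : (ι → X) × X => Function.update p.1 t p.2)
      ((Measure.pi fun _ : ι => ρ).prod ρ) (Measure.pi fun _ : ι => ρ) := by
  have hm : Measurable fun p : (ι → X) × X => Function.update p.1 t p.2 := by
    refine measurable_pi_lambda _ fun i => ?_
    by_cases h : i = t
    · subst h
      simpa using measurable_snd
    · simpa [Function.update_of_ne h] using measurable_fst.eval
  refine ⟨hm, (Measure.pi_eq fun S hS => ?_).symm⟩
  -- The preimage of a box is again a box: side `t` is freed and its constraint moves to the new
  -- sample.
  have hpre : (fun p : (ι → X) × X => Function.update p.1 t p.2) ⁻¹' Set.univ.pi S =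
      (Set.univ.pi (Function.update S t Set.univ)) ×ˢ S t := by
    ext p
    simp only [Set.mem_preimage, Set.mem_univ_pi, Set.mem_prod]
    constructor
    · intro h
      refine ⟨fun i => ?_, by simpa using h t⟩
      by_cases hi : i = t
      · subst hi
        simp
      · simpa [Function.update_of_ne hi] using h i
    · rintro ⟨h1, h2⟩ i
      by_cases hi : i = t
      · subst hi
        simpa using h2
      · simpa [Function.update_of_ne hi] using h1 i
  rw [Measure.map_apply hm (MeasurableSet.univ_pi hS), hpre, Measure.prod_prod, Measure.pi_pi,
    ← Finset.mul_prod_erase _ _ (Finset.mem_univ t), ← Finset.mul_prod_erase _ _ (Finset.mem_univ t)]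
  rw [Finset.prod_congr rfl fun i hi => by
    rw [Function.update_of_ne (Finset.ne_of_mem_erase hi)]]
  simp [mul_comm]

section

variable {n d T : ℕ} {Ξ : Type*}
  {g : EuclideanSpace ℝ (Fin d) → Ξ → EuclideanSpace ℝ (Fin d)} {D R lr : ℝ}

lemma iterate_zero (ω : EuclideanSpace ℝ (Fin d) × (Fin T → RoundSeed n d Ξ)) :
    iterate D R lr g ω 0 = ω.1 := Fin.induction_zero _ _

lemma iterate_succ (ω : EuclideanSpace ℝ (Fin d) × (Fin T → RoundSeed n d Ξ)) (t : Fin T) :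
    iterate D R lr g ω t.succ = sgdStep D R lr g (iterate D R lr g ω t.castSucc) (ω.2 t) :=
  Fin.induction_succ _ _ _

/-- Causality: an iterate sees only the earlier rounds. This is what independence of the current
round rests on. -/
lemma iterate_congr {ω ω' : EuclideanSpace ℝ (Fin d) × (Fin T → RoundSeed n d Ξ)}
    (h : ω.1 = ω'.1) (m : Fin (T + 1)) (hm : ∀ t : Fin T, (t : ℕ) < m → ω.2 t = ω'.2 t) :
    iterate D R lr g ω m = iterate D R lr g ω' m := by
  induction m using Fin.induction with
  | zero => rw [iterate_zero, iterate_zero, h]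
  | succ t ih =>
    rw [iterate_succ, iterate_succ, hm t (by simp),
      ih fun t' ht' => hm t' (by simp at ht' ⊢; omega)]

variable [MeasurableSpace Ξ]

lemma measurable_sgdStep (hg : Measurable (Function.uncurry g)) :
    Measurable fun p : EuclideanSpace ℝ (Fin d) × RoundSeed n d Ξ =>
      sgdStep D R lr g p.1 p.2 := by
  have h : Measurable fun p : EuclideanSpace ℝ (Fin d) × RoundSeed n d Ξ =>
      p.1 - lr • quantizedGradient R g p.1 p.2 :=
    measurable_fst.sub ((measurable_quantizedGradient hg R).const_smul lr)
  have := (measurable_projBall D).comp h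
  exact this

lemma measurable_iterate (hg : Measurable (Function.uncurry g)) (m : Fin (T + 1)) :
    Measurable fun ω : EuclideanSpace ℝ (Fin d) × (Fin T → RoundSeed n d Ξ) =>
      iterate D R lr g ω m := by
  induction m using Fin.induction with
  | zero =>
    simp only [iterate_zero]
    exact measurable_fst
  | succ t ih =>
    simp only [iterate_succ]
    have := (measurable_sgdStep (D := D) (R := R) (lr := lr) (n := n) hg).comp
      (ih.prodMk (measurable_snd.eval (a := t)))
    exact this

lemma runLaw_eq (n d T : ℕ) (P : Measure Ξ) (μ₀ : Measure (EuclideanSpace ℝ (Fin d))) :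
    runLaw n d T P μ₀ = μ₀.prod (Measure.pi fun _ : Fin T => roundLaw n d P) := rfl

variable {P : Measure Ξ} [IsProbabilityMeasure P] {μ₀ : Measure (EuclideanSpace ℝ (Fin d))}
  [IsProbabilityMeasure μ₀]

lemma isProbabilityMeasure_runLaw (hn : 0 < n) (T : ℕ) :
    IsProbabilityMeasure (runLaw n d T P μ₀) := by
  have := isProbabilityMeasure_roundLaw hn d P
  rw [runLaw_eq]
  infer_instance

/-- The randomness of a round is independent of the iterate at which the round starts. -/
lemma measurePreserving_iterate_prodMk (hg : Measurable (Function.uncurry g)) (hn : 0 < n)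
    (t : Fin T) :
    MeasurePreserving
      (fun ω : EuclideanSpace ℝ (Fin d) × (Fin T → RoundSeed n d Ξ) =>
        (iterate D R lr g ω t.castSucc, ω.2 t))
      (runLaw n d T P μ₀)
      (((runLaw n d T P μ₀).map fun ω => iterate D R lr g ω t.castSucc).prod
        (roundLaw n d P)) := by
  have hρ := isProbabilityMeasure_roundLaw hn d P
  have hμ := isProbabilityMeasure_runLaw (P := P) (μ₀ := μ₀) hn T
  have hit := measurable_iterate (D := D) (R := R) (lr := lr) (n := n) (T := T) hg t.castSucc
  have hf : Measurable fun ω : EuclideanSpace ℝ (Fin d) × (Fin T → RoundSeed n d Ξ) =>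
      (iterate D R lr g ω t.castSucc, ω.2 t) := hit.prodMk measurable_snd.eval
  -- Round `t` is replaced by a fresh independent copy. The law of the run is unchanged, the iterate
  -- ignores the replacement, and the pair becomes a product map under a product measure.
  have h1 := ((MeasurePreserving.id μ₀).prod (measurePreserving_update (roundLaw n d P) t)).comp
    (measurePreserving_prodAssoc μ₀ (Measure.pi fun _ : Fin T => roundLaw n d P) (roundLaw n d P))
  rw [← runLaw_eq] at h1
  refine ⟨hf, ?_⟩
  rw [← h1.map_eq, Measure.map_map hf h1.measurable]
  have hcomp : (fun ω : EuclideanSpace ℝ (Fin d) × (Fin T → RoundSeed n d Ξ) =>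
      (iterate D R lr g ω t.castSucc, ω.2 t)) ∘
      (Prod.map id (fun p : (Fin T → RoundSeed n d Ξ) × RoundSeed n d Ξ =>
        Function.update p.1 t p.2) ∘ MeasurableEquiv.prodAssoc) =
      Prod.map (fun ω : EuclideanSpace ℝ (Fin d) × (Fin T → RoundSeed n d Ξ) =>
        iterate D R lr g ω t.castSucc) id := by
    funext p
    refine Prod.ext ?_ ?_
    · change iterate D R lr g (p.1.1, Function.update p.1.2 t p.2) t.castSucc =
        iterate D R lr g p.1 t.castSucc
      refine iterate_congr (ω := (p.1.1, Function.update p.1.2 t p.2)) (ω' := p.1) rfl _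
        fun t' ht' => ?_
      have : t' ≠ t := by
        rintro rfl
        simp at ht'
      exact Function.update_of_ne this _ _
    · exact Function.update_self _ _ _
  rw [hcomp, ← Measure.map_prod_map _ _ hit measurable_id, Measure.map_id, h1.map_eq]

end

/-! ## Convergence -/

/-- `F` is controlled only on the ball, so measurability passes through the restriction of `F` to
it. This is why `f` must lie in the ball everywhere and not just almost surely. -/
lemma integrable_comp_of_mem_closedBall {d : ℕ} {Ω : Type*} [MeasurableSpace Ω] {μ : Measure Ω}
    [IsFiniteMeasure μ] {D : ℝ} {F : EuclideanSpace ℝ (Fin d) → ℝ}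
    (hF : ContinuousOn F (Metric.closedBall 0 D)) {f : Ω → EuclideanSpace ℝ (Fin d)}
    (hf : Measurable f) (hfD : ∀ ω, f ω ∈ Metric.closedBall 0 D) :
    Integrable (fun ω => F (f ω)) μ := by
  obtain ⟨C, hC⟩ :=
    (isCompact_closedBall (0 : EuclideanSpace ℝ (Fin d)) D).exists_bound_of_continuousOn hF
  have h := (continuousOn_iff_continuous_domRestrict.1 hF).measurable.comp (hf.subtype_mk (h := hfD))
  have h' : Measurable fun ω => F (f ω) := h
  exact Integrable.of_bound h'.aestronglyMeasurable C
    (Filter.Eventually.of_forall fun ω => hC _ (hfD ω))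

section

variable {n d T : ℕ} {Ξ : Type*}
  {g : EuclideanSpace ℝ (Fin d) → Ξ → EuclideanSpace ℝ (Fin d)} {D R σ H η lr : ℝ}
  {F : EuclideanSpace ℝ (Fin d) → ℝ}

lemma sgdStep_mem (hD : 0 ≤ D) (w : EuclideanSpace ℝ (Fin d)) (s : RoundSeed n d Ξ) :
    sgdStep D R lr g w s ∈ Metric.closedBall 0 D :=
  mem_closedBall_zero_iff.2 (norm_projBall_le hD _)

lemma averagedIterate_eq (ω : EuclideanSpace ℝ (Fin d) × (Fin T → RoundSeed n d Ξ)) :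
    averagedIterate D R lr g ω = ∑ t : Fin T, (1 / (T : ℝ)) • iterate D R lr g ω t.succ := by
  rw [averagedIterate, Finset.smul_sum]

lemma iterate_succ_mem (hD : 0 ≤ D) (ω : EuclideanSpace ℝ (Fin d) × (Fin T → RoundSeed n d Ξ))
    (t : Fin T) : iterate D R lr g ω t.succ ∈ Metric.closedBall 0 D := by
  rw [iterate_succ]
  exact sgdStep_mem hD _ _

lemma averagedIterate_mem (hT : 0 < T) (hD : 0 ≤ D)
    (ω : EuclideanSpace ℝ (Fin d) × (Fin T → RoundSeed n d Ξ)) :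
    averagedIterate D R lr g ω ∈ Metric.closedBall 0 D := by
  rw [averagedIterate_eq]
  refine (convex_closedBall 0 D).sum_mem (fun _ _ => by positivity) ?_
    fun t _ => iterate_succ_mem hD ω t
  have hT' : (T : ℝ) ≠ 0 := by exact_mod_cast hT.ne'
  simp [hT']

variable [MeasurableSpace Ξ] {P : Measure Ξ} [IsProbabilityMeasure P]
  {μ₀ : Measure (EuclideanSpace ℝ (Fin d))}

lemma ae_iterate_mem (hn : 0 < n) (hD : 0 ≤ D) (h₀ : ∀ᵐ w ∂μ₀, w ∈ Metric.closedBall 0 D)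
    (m : Fin (T + 1)) :
    ∀ᵐ ω ∂runLaw n d T P μ₀, iterate D R lr g ω m ∈ Metric.closedBall 0 D := by
  have := isProbabilityMeasure_roundLaw hn d P
  refine Fin.cases ?_ (fun t => ?_) m
  · simp only [iterate_zero]
    rw [runLaw_eq]
    exact Measure.quasiMeasurePreserving_fst.ae h₀
  · refine Filter.Eventually.of_forall fun ω => ?_
    exact iterate_succ_mem hD ω t

lemma ae_map_iterate_mem (hg : Measurable (Function.uncurry g)) (hn : 0 < n) (hD : 0 ≤ D)
    (h₀ : ∀ᵐ w ∂μ₀, w ∈ Metric.closedBall 0 D) (m : Fin (T + 1)) :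
    ∀ᵐ w ∂(runLaw n d T P μ₀).map fun ω => iterate D R lr g ω m, w ∈ Metric.closedBall 0 D :=
  (ae_map_iff (p := fun w => w ∈ Metric.closedBall 0 D) (measurable_iterate hg m).aemeasurable
    Metric.isClosed_closedBall.measurableSet).2 (ae_iterate_mem hn hD h₀ m)

variable [IsProbabilityMeasure μ₀]

/-- Expected progress of one round. -/
lemma integral_sgdStep_le (hg : IsGradientOracle F D R σ P g) (hn : 0 < n) (hD : 0 ≤ D)
    (hR : 0 < R) (hσ : 0 ≤ σ) (hH0 : 0 ≤ H) (hη : 0 < η)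
    (hF : ConvexOn ℝ (Metric.closedBall 0 D) F)
    (hd : ∀ w ∈ Metric.closedBall 0 D, DifferentiableAt ℝ F w)
    (hH : ∀ w ∈ Metric.closedBall 0 D, ∀ w' ∈ Metric.closedBall 0 D,
      ‖gradient F w - gradient F w'‖ ≤ H * ‖w - w'‖)
    {w u : EuclideanSpace ℝ (Fin d)} (hw : w ∈ Metric.closedBall 0 D)
    (hu : u ∈ Metric.closedBall 0 D) :
    ∫ s, (F (sgdStep D R (1 / (H + 1 / η)) g w s) +
        (H + 1 / η) / 2 * ‖sgdStep D R (1 / (H + 1 / η)) g w s - u‖ ^ 2) ∂roundLaw n d P ≤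
      F u + (H + 1 / η) / 2 * ‖w - u‖ ^ 2 +
        η / 2 * (144 * (σ * R / n + R ^ 2 / n ^ 2)) := by
  have hprob := isProbabilityMeasure_roundLaw hn d P
  have hwD := mem_closedBall_zero_iff.1 hw
  have hFc : ContinuousOn F (Metric.closedBall 0 D) := fun x hx =>
    (hd x hx).continuousAt.continuousWithinAt
  have hΨ : ContinuousOn (fun x => F x + (H + 1 / η) / 2 * ‖x - u‖ ^ 2) (Metric.closedBall 0 D) :=
    hFc.add (Continuous.continuousOn (by fun_prop))
  have hstep : Measurable fun s : RoundSeed n d Ξ => sgdStep D R (1 / (H + 1 / η)) g w s := by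
    have := (measurable_sgdStep (D := D) (R := R) (lr := 1 / (H + 1 / η)) (n := n)
      hg.measurable).comp (measurable_prodMk_left (x := w))
    exact this
  have hint := integrable_comp_of_mem_closedBall (μ := roundLaw n d P) hΨ hstep
    fun s => sgdStep_mem hD w s
  have hsq := hg.integrable_norm_quantizedGradient_sub_sq hn hR hwD
  obtain ⟨hi1, hi2⟩ := hg.integral_quantizedGradient_sub_inner hn hR hwD (u - w)
  set A := F u + (H + 1 / η) / 2 * ‖w - u‖ ^ 2 with hA
  have hsum : Integrable (fun s => A + η / 2 * ‖quantizedGradient R g w s - gradient F w‖ ^ 2)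
      (roundLaw n d P) := (integrable_const _).add (hsq.const_mul _)
  calc _ ≤ ∫ s, (A + η / 2 * ‖quantizedGradient R g w s - gradient F w‖ ^ 2 +
          inner ℝ (quantizedGradient R g w s - gradient F w) (u - w)) ∂roundLaw n d P :=
        integral_mono hint (hsum.add hi1) fun s =>
          projBall_step_le hD hH0 hη hF hd hH hw hu (quantizedGradient R g w s)
    _ = A + η / 2 * ∫ s, ‖quantizedGradient R g w s - gradient F w‖ ^ 2 ∂roundLaw n d P := by
        rw [integral_add hsum hi1, hi2, integral_add (integrable_const _) (hsq.const_mul _),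
          integral_const_mul]
        simp
    _ ≤ _ := by
        have := hg.integral_norm_quantizedGradient_sub_sq_le hn hR hσ hwD
        gcongr

lemma integrable_norm_iterate_sub_sq (hg : Measurable (Function.uncurry g)) (hn : 0 < n)
    (hD : 0 ≤ D) (h₀ : ∀ᵐ w ∂μ₀, w ∈ Metric.closedBall 0 D) (u : EuclideanSpace ℝ (Fin d))
    (m : Fin (T + 1)) :
    Integrable (fun ω => ‖iterate D R lr g ω m - u‖ ^ 2) (runLaw n d T P μ₀) := by
  have := isProbabilityMeasure_runLaw (d := d) (P := P) (μ₀ := μ₀) hn T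
  refine integrable_sq_of_abs_le
    ((measurable_iterate hg m).sub_const u).norm.aestronglyMeasurable (C := D + ‖u‖) ?_
  filter_upwards [ae_iterate_mem (R := R) (lr := lr) (g := g) (P := P) hn hD h₀ m] with ω hω
  rw [abs_norm]
  exact (norm_sub_le _ _).trans (by have := mem_closedBall_zero_iff.1 hω; gcongr)

/-- The pair of old iterate and new randomness has a product law, so Fubini reduces the claim to
`integral_sgdStep_le` at a fixed point of the ball. -/
lemma integral_iterate_succ_le (hg : IsGradientOracle F D R σ P g) (hn : 0 < n) (hD : 0 ≤ D)
    (hR : 0 < R) (hσ : 0 ≤ σ) (hH0 : 0 ≤ H) (hη : 0 < η)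
    (hF : ConvexOn ℝ (Metric.closedBall 0 D) F)
    (hd : ∀ w ∈ Metric.closedBall 0 D, DifferentiableAt ℝ F w)
    (hH : ∀ w ∈ Metric.closedBall 0 D, ∀ w' ∈ Metric.closedBall 0 D,
      ‖gradient F w - gradient F w'‖ ≤ H * ‖w - w'‖)
    (h₀ : ∀ᵐ w ∂μ₀, w ∈ Metric.closedBall 0 D)
    {u : EuclideanSpace ℝ (Fin d)} (hu : u ∈ Metric.closedBall 0 D) (t : Fin T) :
    ∫ ω, F (iterate D R (1 / (H + 1 / η)) g ω t.succ) ∂runLaw n d T P μ₀ +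
        (H + 1 / η) / 2 *
          ∫ ω, ‖iterate D R (1 / (H + 1 / η)) g ω t.succ - u‖ ^ 2 ∂runLaw n d T P μ₀ ≤
      F u + (H + 1 / η) / 2 *
          ∫ ω, ‖iterate D R (1 / (H + 1 / η)) g ω t.castSucc - u‖ ^ 2 ∂runLaw n d T P μ₀ +
        η / 2 * (144 * (σ * R / n + R ^ 2 / n ^ 2)) := by
  have hρ := isProbabilityMeasure_roundLaw hn d P
  have hμ := isProbabilityMeasure_runLaw (d := d) (P := P) (μ₀ := μ₀) hn T
  set lr := 1 / (H + 1 / η) with hlr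
  set K := (H + 1 / η) / 2 with hK
  set V := η / 2 * (144 * (σ * R / n + R ^ 2 / n ^ 2)) with hV
  have hFc : ContinuousOn F (Metric.closedBall 0 D) := fun x hx =>
    (hd x hx).continuousAt.continuousWithinAt
  have hΨ : ContinuousOn (fun x => F x + K * ‖x - u‖ ^ 2) (Metric.closedBall 0 D) :=
    hFc.add (Continuous.continuousOn (by fun_prop))
  have hit := measurable_iterate (D := D) (R := R) (lr := lr) (n := n) (T := T) hg.measurable
  set ν := (runLaw n d T P μ₀).map fun ω => iterate D R lr g ω t.castSucc with hν
  have hνprob : IsProbabilityMeasure ν := Measure.isProbabilityMeasure_map (hit _).aemeasurable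
  have hmp := measurePreserving_iterate_prodMk (D := D) (R := R) (lr := lr) (P := P) (μ₀ := μ₀)
    hg.measurable hn t
  have hstep := measurable_sgdStep (D := D) (R := R) (lr := lr) (n := n) hg.measurable
  have hint := integrable_comp_of_mem_closedBall (μ := ν.prod (roundLaw n d P)) hΨ hstep
    fun p => sgdStep_mem hD p.1 p.2
  have hiF := integrable_comp_of_mem_closedBall (μ := runLaw n d T P μ₀) hFc (hit t.succ)
    fun ω => iterate_succ_mem hD ω t
  have hsq := fun m => integrable_norm_iterate_sub_sq (R := R) (lr := lr) (T := T) (P := P)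
    hg.measurable hn hD h₀ u m
  have hνmem : ∀ᵐ w ∂ν, w ∈ Metric.closedBall 0 D :=
    ae_map_iterate_mem hg.measurable hn hD h₀ _
  have hνsq : Integrable (fun w => ‖w - u‖ ^ 2) ν := by
    rw [hν, integrable_map_measure (Continuous.aestronglyMeasurable (by fun_prop))
      (hit _).aemeasurable]
    exact hsq _
  calc _ = ∫ ω, (F (iterate D R lr g ω t.succ) + K * ‖iterate D R lr g ω t.succ - u‖ ^ 2)
          ∂runLaw n d T P μ₀ := by
        rw [integral_add hiF ((hsq _).const_mul K), integral_const_mul]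
    _ = ∫ p, (F (sgdStep D R lr g p.1 p.2) + K * ‖sgdStep D R lr g p.1 p.2 - u‖ ^ 2)
          ∂ν.prod (roundLaw n d P) := by
        simp only [iterate_succ]
        rw [← hmp.map_eq, integral_map hmp.measurable.aemeasurable
          (by rw [hmp.map_eq]; exact hint.aestronglyMeasurable)]
    _ = ∫ w, ∫ s, (F (sgdStep D R lr g w s) + K * ‖sgdStep D R lr g w s - u‖ ^ 2)
          ∂roundLaw n d P ∂ν := integral_prod _ hint
    _ ≤ ∫ w, (F u + K * ‖w - u‖ ^ 2 + V) ∂ν := by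
        refine integral_mono_ae hint.integral_prod_left
          (((integrable_const _).add (hνsq.const_mul K)).add (integrable_const _)) ?_
        filter_upwards [hνmem] with w hw
        exact integral_sgdStep_le hg hn hD hR hσ hH0 hη hF hd hH hw hu
    _ = F u + K * ∫ w, ‖w - u‖ ^ 2 ∂ν + V := by
        have h1 : Integrable (fun w => F u + K * ‖w - u‖ ^ 2) ν :=
          (integrable_const _).add (hνsq.const_mul K)
        rw [integral_add h1 (integrable_const _), integral_add (integrable_const _)
          (hνsq.const_mul K), integral_const_mul]
        simp
    _ = _ := by
        rw [hν, integral_map (hit _).aemeasurable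
          (Continuous.aestronglyMeasurable (by fun_prop))]

/-- The mean zero of the start kills the cross term, giving `2D²` instead of the `4D²` that the
diameter would give. -/
lemma integral_norm_initial_sub_sq_le (h₀ : ∀ᵐ w ∂μ₀, w ∈ Metric.closedBall 0 D)
    (hmean : ∫ w, w ∂μ₀ = 0) {u : EuclideanSpace ℝ (Fin d)} (hu : u ∈ Metric.closedBall 0 D) :
    ∫ w, ‖w - u‖ ^ 2 ∂μ₀ ≤ 2 * D ^ 2 := by
  have hid : Integrable (fun w : EuclideanSpace ℝ (Fin d) => w) μ₀ :=
    Integrable.of_bound aestronglyMeasurable_id D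
      (h₀.mono fun w hw => mem_closedBall_zero_iff.1 hw)
  have hin : Integrable (fun w => inner ℝ u w) μ₀ := hid.const_inner u
  have hsq : Integrable (fun w => ‖w - u‖ ^ 2) μ₀ := by
    refine integrable_sq_of_abs_le (Continuous.aestronglyMeasurable (by fun_prop))
      (C := D + ‖u‖) (h₀.mono fun w hw => ?_)
    rw [abs_norm]
    exact (norm_sub_le _ _).trans (by have := mem_closedBall_zero_iff.1 hw; gcongr)
  calc _ ≤ ∫ w, (2 * D ^ 2 - 2 * inner ℝ u w) ∂μ₀ := by
        refine integral_mono_ae hsq ((integrable_const _).sub (hin.const_mul 2)) ?_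
        filter_upwards [h₀] with w hw
        have h1 := mem_closedBall_zero_iff.1 hw
        have h2 := mem_closedBall_zero_iff.1 hu
        rw [norm_sub_sq_real, real_inner_comm]
        have h3 := pow_le_pow_left₀ (norm_nonneg _) h1 2
        have h4 := pow_le_pow_left₀ (norm_nonneg _) h2 2
        linarith
    _ = 2 * D ^ 2 := by
        rw [integral_sub (integrable_const _) (hin.const_mul 2), integral_const_mul 2 (fun w => inner ℝ u w),
          integral_inner hid u, hmean]
        simp

lemma integrable_averagedIterate (hg : Measurable (Function.uncurry g)) (hn : 0 < n) (hT : 0 < T)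
    (hD : 0 ≤ D) (hF : ContinuousOn F (Metric.closedBall 0 D)) :
    Integrable (fun ω => F (averagedIterate D R lr g ω)) (runLaw n d T P μ₀) := by
  have hμ := isProbabilityMeasure_runLaw (d := d) (P := P) (μ₀ := μ₀) hn T
  refine integrable_comp_of_mem_closedBall hF ?_ fun ω => averagedIterate_mem hT hD ω
  have h : Measurable fun ω : EuclideanSpace ℝ (Fin d) × (Fin T → RoundSeed n d Ξ) =>
      ∑ t : Fin T, iterate D R lr g ω t.succ :=
    Finset.measurable_fun_sum _ fun t _ => measurable_iterate hg t.succ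
  exact h.const_smul (1 / (T : ℝ))

/-- Convergence of distributed SGD with correlated quantization. -/
lemma integral_averagedIterate_sub_le (hg : IsGradientOracle F D R σ P g) (hn : 0 < n)
    (hT : 0 < T) (hD : 0 ≤ D) (hR : 0 < R) (hσ : 0 ≤ σ) (hH0 : 0 ≤ H) (hη : 0 < η)
    (hF : ConvexOn ℝ (Metric.closedBall 0 D) F)
    (hd : ∀ w ∈ Metric.closedBall 0 D, DifferentiableAt ℝ F w)
    (hH : ∀ w ∈ Metric.closedBall 0 D, ∀ w' ∈ Metric.closedBall 0 D,
      ‖gradient F w - gradient F w'‖ ≤ H * ‖w - w'‖)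
    (h₀ : ∀ᵐ w ∂μ₀, w ∈ Metric.closedBall 0 D) (hmean : ∫ w, w ∂μ₀ = 0)
    {u : EuclideanSpace ℝ (Fin d)} (hu : u ∈ Metric.closedBall 0 D) :
    ∫ ω, F (averagedIterate D R (1 / (H + 1 / η)) g ω) ∂runLaw n d T P μ₀ - F u ≤
      (H + 1 / η) * (D ^ 2 / T) + η * (144 * (σ * R / n + R ^ 2 / n ^ 2)) / 2 := by
  have hρ := isProbabilityMeasure_roundLaw hn d P
  have hμ := isProbabilityMeasure_runLaw (d := d) (P := P) (μ₀ := μ₀) hn T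
  have hT' : (0 : ℝ) < T := by exact_mod_cast hT
  have hFc : ContinuousOn F (Metric.closedBall 0 D) := fun x hx =>
    (hd x hx).continuousAt.continuousWithinAt
  have hstep := fun t : Fin T => integral_iterate_succ_le hg hn hD hR hσ hH0 hη hF hd hH h₀ hu t
  set lr := 1 / (H + 1 / η) with hlr
  set K := (H + 1 / η) / 2 with hK
  have hK0 : 0 ≤ K := by positivity
  set V := η / 2 * (144 * (σ * R / n + R ^ 2 / n ^ 2)) with hV
  set a : Fin (T + 1) → ℝ := fun m => ∫ ω, ‖iterate D R lr g ω m - u‖ ^ 2 ∂runLaw n d T P μ₀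
    with ha
  have hiF := fun t : Fin T => integrable_comp_of_mem_closedBall (μ := runLaw n d T P μ₀) hFc
    (measurable_iterate (D := D) (R := R) (lr := lr) hg.measurable t.succ)
    fun ω => iterate_succ_mem hD ω t
  have ha0 : a 0 ≤ 2 * D ^ 2 := by
    simp only [ha, iterate_zero]
    rw [runLaw_eq, integral_fun_fst (fun w => ‖w - u‖ ^ 2)]
    simpa using integral_norm_initial_sub_sq_le h₀ hmean hu
  have halast : 0 ≤ a (Fin.last T) := integral_nonneg fun ω => by positivity
  have htel : ∑ t : Fin T, (a t.castSucc - a t.succ) = a 0 - a (Fin.last T) := by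
    rw [Finset.sum_sub_distrib]
    have h1 := Fin.sum_univ_succ a
    have h2 := Fin.sum_univ_castSucc a
    linarith
  have hsum : ∑ t : Fin T, ∫ ω, F (iterate D R lr g ω t.succ) ∂runLaw n d T P μ₀ ≤
      T * F u + K * (2 * D ^ 2) + T * V := by
    calc _ ≤ ∑ t : Fin T, (F u + K * (a t.castSucc - a t.succ) + V) :=
          Finset.sum_le_sum fun t _ => by
            have h := hstep t
            change _ + K * a t.succ ≤ _ + K * a t.castSucc + _ at h
            linarith
      _ = T * F u + K * (a 0 - a (Fin.last T)) + T * V := by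
          rw [Finset.sum_add_distrib, Finset.sum_add_distrib, ← Finset.mul_sum, htel]
          simp
      _ ≤ _ := by
          gcongr
          linarith
  have hjensen : ∫ ω, F (averagedIterate D R lr g ω) ∂runLaw n d T P μ₀ ≤
      1 / (T : ℝ) * ∑ t : Fin T, ∫ ω, F (iterate D R lr g ω t.succ) ∂runLaw n d T P μ₀ := by
    rw [← integral_finsetSum _ fun t _ => hiF t, ← integral_const_mul]
    refine integral_mono (integrable_averagedIterate hg.measurable hn hT hD hFc)
      ((integrable_finsetSum _ fun t _ => hiF t).const_mul _) fun ω => ?_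
    simp only [averagedIterate_eq, Finset.mul_sum]
    exact hF.map_sum_le (fun _ _ => by positivity) (by simp [hT'.ne'])
      fun t _ => iterate_succ_mem hD ω t
  -- The factor `2` in `2D²` cancels the `1/2` in `K`, which leaves `(H + 1/η) D² / T`.
  calc _ ≤ 1 / (T : ℝ) * (T * F u + K * (2 * D ^ 2) + T * V) - F u := by
        gcongr
        exact hjensen.trans (by gcongr)
    _ = _ := by
        rw [hK, hV]
        field_simp
        ring

lemma measurableSet_isGoodSeed (k n : ℕ) : MeasurableSet {s : CoordSeed n | IsGoodSeed k s} := by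
  have h1 : MeasurableSet {s : CoordSeed n | s.1 ∈ Set.Ico (-(1 / (k : ℝ))) 0} :=
    measurable_fst measurableSet_Ico
  have h2 : MeasurableSet {s : CoordSeed n | ∀ i, s.2.2 i ∈ Set.Ico (0 : ℝ) (1 / (n : ℝ))} := by
    rw [Set.ofPred_forall]
    exact MeasurableSet.iInter fun i => measurable_snd.snd.eval measurableSet_Ico
  exact h1.inter h2

/-- Almost surely the messages of a round have length between `d` and `22 d`. -/
lemma ae_length_clientMessage (hg : IsGradientOracle F D R σ P g) (hdim : 0 < d) (hn : 0 < n)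
    (hD : 0 ≤ D) (hR : 0 < R) (h₀ : ∀ᵐ w ∂μ₀, w ∈ Metric.closedBall 0 D) :
    ∀ᵐ ω ∂runLaw n d T P μ₀, ∀ (t : Fin T) (i : Fin n),
      1 * (d : ℝ) ≤ (clientMessage R g (iterate D R lr g ω t.castSucc) (ω.2 t) i).length ∧
      ((clientMessage R g (iterate D R lr g ω t.castSucc) (ω.2 t) i).length : ℝ) ≤ 22 * d := by
  have hρ := isProbabilityMeasure_roundLaw hn d P
  have hμ := isProbabilityMeasure_runLaw (d := d) (P := P) (μ₀ := μ₀) hn T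
  rw [ae_all_iff]
  intro t
  -- Measurability of this set allows an almost sure statement for each fixed `w` to be lifted to
  -- the random iterate.
  set A : Set (EuclideanSpace ℝ (Fin d) × RoundSeed n d Ξ) :=
    {p | (∀ i, ‖g p.1 (p.2.1 i)‖ ≤ R) ∧ ∀ j, IsGoodSeed (numLevels d) (p.2.2 j)} with hA
  have hAm : MeasurableSet A := by
    refine MeasurableSet.inter ?_ ?_
    · change MeasurableSet {p | _}
      rw [Set.ofPred_forall]
      refine MeasurableSet.iInter fun i => ?_
      have h3 : Measurable fun p : EuclideanSpace ℝ (Fin d) × RoundSeed n d Ξ => (p.1, p.2.1 i) :=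
        measurable_fst.prodMk measurable_snd.fst.eval
      exact measurableSet_le (hg.measurable.comp h3).norm measurable_const
    · change MeasurableSet {p | _}
      rw [Set.ofPred_forall]
      refine MeasurableSet.iInter fun j => ?_
      have h3 : Measurable fun p : EuclideanSpace ℝ (Fin d) × RoundSeed n d Ξ => p.2.2 j :=
        measurable_snd.snd.eval
      exact h3 (measurableSet_isGoodSeed (numLevels d) n)
  have hmp := measurePreserving_iterate_prodMk (D := D) (R := R) (lr := lr) (P := P) (μ₀ := μ₀)
    hg.measurable hn t
  have hae : ∀ᵐ p ∂((runLaw n d T P μ₀).map fun ω => iterate D R lr g ω t.castSucc).prod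
      (roundLaw n d P), p ∈ A := by
    refine (Measure.ae_prod_iff_ae_ae (p := fun p => p ∈ A) hAm).2 ?_
    filter_upwards [ae_map_iterate_mem hg.measurable hn hD h₀ t.castSucc] with w hw
    exact hg.ae_roundLaw hn (mem_closedBall_zero_iff.1 hw)
  filter_upwards [hmp.quasiMeasurePreserving.ae hae] with ω hω i
  refine ⟨?_, length_message_le hdim hR (hω.1 i) hω.2 i⟩
  rw [one_mul]
  exact_mod_cast le_length_encode _ _

end

end

end CQ

theorem mainTheorem3 :
    ∃ C : ℝ, 0 < C ∧ ∃ a b : ℝ, 0 < a ∧ 0 < b ∧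
      ∀ (d n T : ℕ), 0 < d → 0 < n → 0 < T →
      ∀ (D R σ H η : ℝ), 0 ≤ D → 0 < R → 0 ≤ σ → 0 ≤ H → 0 < η →
      ∀ (F : EuclideanSpace ℝ (Fin d) → ℝ),
        ConvexOn ℝ (Metric.closedBall 0 D) F →
        (∀ w ∈ Metric.closedBall 0 D, DifferentiableAt ℝ F w) →
        (∀ w ∈ Metric.closedBall 0 D, ∀ w' ∈ Metric.closedBall 0 D,
          ‖gradient F w - gradient F w'‖ ≤ H * ‖w - w'‖) →
      ∀ (Ξ : Type*) [MeasurableSpace Ξ] (P : MeasureTheory.Measure Ξ)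
        [MeasureTheory.IsProbabilityMeasure P]
        (g : EuclideanSpace ℝ (Fin d) → Ξ → EuclideanSpace ℝ (Fin d)),
        CQ.IsGradientOracle F D R σ P g →
      ∀ (μ₀ : MeasureTheory.Measure (EuclideanSpace ℝ (Fin d)))
        [MeasureTheory.IsProbabilityMeasure μ₀],
        (∀ᵐ w ∂μ₀, w ∈ Metric.closedBall 0 D) → ∫ w, w ∂μ₀ = 0 →
      -- convergence of the averaged iterate, with learning rate `1 / (H + 1 / η)`
      (MeasureTheory.Integrable
          (fun ω => F (CQ.averagedIterate D R (1 / (H + 1 / η)) g ω)) (CQ.runLaw n d T P μ₀) ∧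
        ∃ wmin ∈ Metric.closedBall 0 D, IsMinOn F (Metric.closedBall 0 D) wmin ∧
          (∫ ω, F (CQ.averagedIterate D R (1 / (H + 1 / η)) g ω) ∂(CQ.runLaw n d T P μ₀)) - F wmin
            ≤ (H + 1 / η) * (D ^ 2 / T) + η * (C * (σ * R / n + R ^ 2 / n ^ 2)) / 2) ∧
      -- every client sends between `a * d` and `b * d` bits in every round
      (∀ᵐ ω ∂(CQ.runLaw n d T P μ₀), ∀ (t : Fin T) (i : Fin n),
        a * d ≤ ((CQ.clientMessage R g
            (CQ.iterate D R (1 / (H + 1 / η)) g ω t.castSucc) (ω.2 t) i).length : ℝ) ∧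
        ((CQ.clientMessage R g
            (CQ.iterate D R (1 / (H + 1 / η)) g ω t.castSucc) (ω.2 t) i).length : ℝ) ≤ b * d) := by

  -- `144` is the constant of the mean squared error; each code word has at least one bit; `22`
  -- comes from `length_message_le`.
  refine ⟨144, by norm_num, 1, 22, one_pos, by norm_num, ?_⟩
  intro d n T hdim hn hT D R σ H η hD hR hσ hH0 hη F hF hd hH Ξ _ P _ g hg μ₀ _ h₀ hmean
  have hFc : ContinuousOn F (Metric.closedBall 0 D) := fun x hx =>
    (hd x hx).continuousAt.continuousWithinAt
  obtain ⟨u, hu, hmin⟩ := (isCompact_closedBall (0 : EuclideanSpace ℝ (Fin d)) D).exists_isMinOn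
    ⟨0, Metric.mem_closedBall_self hD⟩ hFc
  exact ⟨⟨CQ.integrable_averagedIterate hg.measurable hn hT hD hFc, u, hu, hmin,
    CQ.integral_averagedIterate_sub_le hg hn hT hD hR hσ hH0 hη hF hd hH h₀ hmean hu⟩,
    CQ.ae_length_clientMessage hg hdim hn hD hR h₀⟩
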